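/- A \emph{prop} is a strict symmetric monoidal category whose objects are the natural numbers, with monoidal product on objects given by addition; $\mathbf{PROP}$ is the category of props and identity-on-objects strict symmetric monoidal functors. Write $[n]=\{0,\dots,n-1\}$. Let $\mathsf F$ be the prop whose arrows $n\to m$ are the functions $[n]\to[m]$, with monoidal product given by disjoint union, and let $\mathsf{Surj},\mathsf{Inj}\subseteq\mathsf F$ be the sub-props of surjections and of injections; $(\mathsf{Surj},\mathsf{Inj})$ is a factorisation system on $\mathsf F$, and $\mathsf{Inj}$ is closed under monoidal product and stable under pushout. Let $\mathsf{Inj}^{op}$ be the opposite prop and $\mathsf{Inj}+\mathsf{Inj}^{op}$ the coproduct in $\mathbf{PROP}$. Consider the following props, with monoidal product and symmetries induced by those of $\mathsf F$. (a) $\mathsf{Cospan}(\mathsf F)$: arrows $n\to m$ are isomorphism classes of cospans $n\xrightarrow{f}k\xleftarrow{g}m$ in $\mathsf F$, composed by pushout. (b) $\mathsf{Span}(\mathsf{Inj})$: arrows $n\to m$ are isomorphism classes of spans $n\xleftarrow{f}k\xrightarrow{g}m$ in $\mathsf{Inj}$, composed by pullback. (c) $\mathsf{Corel}(\mathsf F)$: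 the quotient of $\mathsf{Cospan}(\mathsf F)$ by the equivalence relation generated by identifying $n\xrightarrow{f}k\xleftarrow{g}m$ with $n\xrightarrow{hf}k'\xleftarrow{hg}m$ for every injection $h:k\to k'$. Let $\Gamma:\mathsf{Cospan}(\mathsf F)\to\mathsf{Corel}(\mathsf F)$ be the quotient morphism. (d) $\mathsf{ER}$: arrows $n\to m$ are the equivalence relations on $[n]\uplus[m]$. The composite of $e_1:n\to z$ and $e_2:z\to m$ is the restriction to $[n]\uplus[m]$ of the equivalence relation on $[n]\uplus[z]\uplus[m]$ generated by $e_1$ and $e_2$. The monoidal product is the disjoint union of equivalence relations. The identity on $n$ relates each element of the left copy of $[n]$ to the same element of the right copy (and to nothing else but itself), and the symmetry $n+m\to m+n$ is given in the same way by the block transposition. Then: 1. There is an isomorphism of props $\varphi:\mathsf{Corel}(\mathsf F)\cong\mathsf{ER}$ that sends the corelation represented by $n\xrightarrow{f}k\xleftarrow{g}m$ to the kernel of the copairing $[f,g]:[n]\uplus[m]\to[k]$. 2. There is a morphism of props $\Pi:\mathsf{Span}(\mathsf{Inj})\to\mathsf{Corel}(\mathsf F)$ that sends a span $n\xleftarrow{f}k\xrightarrow{g}m$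 of injections to the corelation represented by the cospan $n\to p\leftarrow m$ that is a pushout of the span in $\mathsf F$. 3. The square $$\begin{array}{ccc}\mathsf{Inj}+\mathsf{Inj}^{op}&\longrightarrow&\mathsf{Span}(\mathsf{Inj})\\ \downarrow&&\downarrow{\scriptstyle\varphi\circ\Pi}\\ \mathsf{Cospan}(\mathsf F)&\xrightarrow{\ \varphi\circ\Gamma\ }&\mathsf{ER}\end{array}$$ is a pushout in $\mathbf{PROP}$. Here $\mathsf{Inj}+\mathsf{Inj}^{op}\to\mathsf{Cospan}(\mathsf F)$ is the copairing of $f\mapsto(\xrightarrow{f}\xleftarrow{id})$ and $g\mapsto(\xrightarrow{id}\xleftarrow{g})$, and $\mathsf{Inj}+\mathsf{Inj}^{op}\to\mathsf{Span}(\mathsf{Inj})$ is the copairing of $f\mapsto(\xleftarrow{id}\xrightarrow{f})$ and $g\mapsto(\xleftarrow{g}\xrightarrow{id})$. The universal property holds with respect to all props, whatever the universe in which their hom-sets live. -/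

import Mathlib

open CategoryTheory CategoryTheory.Limits

universe u v w

/-! Props: strict symmetric monoidal categories with objects the natural numbers. -/

/-- The operations of a prop. Composition is written in diagrammatic order. -/
structure PROPData where
  Hom : ℕ → ℕ → Type u
  id : ∀ n, Hom n n
  comp : ∀ {n m k}, Hom n m → Hom m k → Hom n k
  tensor : ∀ {a b c d}, Hom a b → Hom c d → Hom (a + c) (b + d)
  symm : ∀ a b, Hom (a + b) (b + a)

/-- Transport of an arrow along equalities of its source and target. -/
def PROPData.cast (D : PROPData.{u}) {a a' b b' : ℕ} (h : a = a') (h' : b = b') (f : D.Hom a b) :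
    D.Hom a' b' := h ▸ h' ▸ f

theorem PROPData.map_cast {D : PROPData.{u}} {D' : PROPData.{v}}
    (K : ∀ {n m : ℕ}, D.Hom n m → D'.Hom n m) {a a' b b' : ℕ} (h : a = a') (h' : b = b')
    (f : D.Hom a b) : D'.cast h h' (K f) = K (D.cast h h' f) := by
  subst h h'; rfl

/-- A prop: a strict symmetric monoidal category whose objects are the natural numbers, with
`n ⊗ m = n + m`. Strictness of the tensor on arrows is expressed by transport along the equalities
`a + b + c = a + (b + c)` and `0 + a = a`. -/
structure PROP extends PROPData.{u} where
  id_comp : ∀ {n m} (f : Hom n m), comp (id n) f = f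
  comp_id : ∀ {n m} (f : Hom n m), comp f (id m) = f
  assoc : ∀ {n m k l} (f : Hom n m) (g : Hom m k) (h : Hom k l),
    comp (comp f g) h = comp f (comp g h)
  tensor_id : ∀ a b, tensor (id a) (id b) = id (a + b)
  tensor_comp : ∀ {a b c a' b' c'} (f : Hom a b) (g : Hom b c) (f' : Hom a' b') (g' : Hom b' c'),
    tensor (comp f g) (comp f' g') = comp (tensor f f') (tensor g g')
  tensor_assoc : ∀ {a b c a' b' c'} (f : Hom a a') (g : Hom b b') (h : Hom c c'),
    toPROPData.cast (Nat.add_assoc a b c) (Nat.add_assoc a' b' c') (tensor (tensor f g) h) =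
      tensor f (tensor g h)
  unit_tensor : ∀ {a b} (f : Hom a b),
    toPROPData.cast (Nat.zero_add a) (Nat.zero_add b) (tensor (id 0) f) = f
  tensor_unit : ∀ {a b} (f : Hom a b),
    toPROPData.cast (Nat.add_zero a) (Nat.add_zero b) (tensor f (id 0)) = f
  symm_natural : ∀ {a b c d} (f : Hom a b) (g : Hom c d),
    comp (tensor f g) (symm b d) = comp (symm a c) (tensor g f)
  symm_symm : ∀ a b, comp (symm a b) (symm b a) = id (a + b)
  hexagon : ∀ a b c,
    toPROPData.cast (Nat.add_assoc a b c).symm (Nat.add_assoc b c a) (symm a (b + c)) =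
      comp (toPROPData.cast rfl (Nat.add_assoc b a c) (tensor (symm a b) (id c)))
        (tensor (id b) (symm a c))

namespace PROP

/-- A morphism of props: an identity-on-objects strict symmetric monoidal functor. -/
@[ext]
structure Mor (P : PROP.{u}) (Q : PROP.{v}) where
  map : ∀ {n m : ℕ}, P.Hom n m → Q.Hom n m
  map_id : ∀ n, map (P.id n) = Q.id n
  map_comp : ∀ {n m k} (f : P.Hom n m) (g : P.Hom m k),
    map (P.comp f g) = Q.comp (map f) (map g)
  map_tensor : ∀ {a b c d} (f : P.Hom a b) (g : P.Hom c d),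
    map (P.tensor f g) = Q.tensor (map f) (map g)
  map_symm : ∀ a b, map (P.symm a b) = Q.symm a b

/-- The identity morphism of a prop. -/
def Mor.refl (P : PROP.{u}) : Mor P P where
  map f := f
  map_id _ := rfl
  map_comp _ _ := rfl
  map_tensor _ _ := rfl
  map_symm _ _ := rfl

/-- The composite of two morphisms of props. -/
def Mor.trans {P : PROP.{u}} {Q : PROP.{v}} {R : PROP.{w}} (F : Mor P Q) (G : Mor Q R) :
    Mor P R where
  map f := G.map (F.map f)
  map_id n := by rw [F.map_id, G.map_id]
  map_comp f g := by rw [F.map_comp, G.map_comp]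
  map_tensor f g := by rw [F.map_tensor, G.map_tensor]
  map_symm a b := by rw [F.map_symm, G.map_symm]

/-- The category of props. -/
instance : Category PROP.{u} where
  Hom P Q := Mor P Q
  id P := Mor.refl P
  comp F G := Mor.trans F G

@[simp] theorem comp_map {P Q R : PROP.{u}} (F : P ⟶ Q) (G : Q ⟶ R) {n m : ℕ} (f : P.Hom n m) :
    Mor.map (F ≫ G) f = Mor.map G (Mor.map F f) := rfl

/-- The underlying category of a prop. -/
structure Obj (P : PROP.{u}) where
  n : ℕ

instance (P : PROP.{u}) : Category P.Obj where
  Hom X Y := P.Hom X.n Y.n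
  id X := P.id X.n
  comp f g := P.comp f g
  id_comp := P.id_comp
  comp_id := P.comp_id
  assoc := P.assoc

/-- The natural number `n`, as an object of the prop `P`. -/
abbrev ob (P : PROP.{u}) (n : ℕ) : P.Obj := ⟨n⟩

/-- An arrow of the prop `P`, as an arrow of its underlying category. -/
abbrev ar (P : PROP.{u}) {n m : ℕ} (f : P.Hom n m) : P.ob n ⟶ P.ob m := f

theorem ar_comp (P : PROP.{u}) {n m k : ℕ} (f : P.Hom n m) (g : P.Hom m k) :
    P.ar (P.comp f g) = P.ar f ≫ P.ar g := rfl

/-- Laws pass along a surjective map compatible with the operations. -/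
def ofSurjective (P : PROP.{u}) (D : PROPData.{v}) (K : ∀ {n m : ℕ}, P.Hom n m → D.Hom n m)
    (hK : ∀ {n m : ℕ} (g : D.Hom n m), ∃ f : P.Hom n m, K f = g)
    (K_id : ∀ n, K (P.id n) = D.id n)
    (K_comp : ∀ {n m k} (f : P.Hom n m) (g : P.Hom m k), K (P.comp f g) = D.comp (K f) (K g))
    (K_tensor : ∀ {a b c d} (f : P.Hom a b) (g : P.Hom c d),
      K (P.tensor f g) = D.tensor (K f) (K g))
    (K_symm : ∀ a b, K (P.symm a b) = D.symm a b) : PROP.{v} where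
  toPROPData := D
  id_comp f := by
    obtain ⟨f, rfl⟩ := hK f
    rw [← K_id, ← K_comp, P.id_comp]
  comp_id f := by
    obtain ⟨f, rfl⟩ := hK f
    rw [← K_id, ← K_comp, P.comp_id]
  assoc f g h := by
    obtain ⟨f, rfl⟩ := hK f
    obtain ⟨g, rfl⟩ := hK g
    obtain ⟨h, rfl⟩ := hK h
    simp only [← K_comp, P.assoc]
  tensor_id a b := by simp only [← K_id, ← K_tensor, P.tensor_id]
  tensor_comp f g f' g' := by
    obtain ⟨f, rfl⟩ := hK f
    obtain ⟨g, rfl⟩ := hK g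
    obtain ⟨f', rfl⟩ := hK f'
    obtain ⟨g', rfl⟩ := hK g'
    simp only [← K_comp, ← K_tensor, P.tensor_comp]
  tensor_assoc f g h := by
    obtain ⟨f, rfl⟩ := hK f
    obtain ⟨g, rfl⟩ := hK g
    obtain ⟨h, rfl⟩ := hK h
    rw [← K_tensor, ← K_tensor, ← K_tensor, ← K_tensor, PROPData.map_cast K, P.tensor_assoc]
  unit_tensor f := by
    obtain ⟨f, rfl⟩ := hK f
    rw [← K_id, ← K_tensor, PROPData.map_cast K, P.unit_tensor]
  tensor_unit f := by
    obtain ⟨f, rfl⟩ := hK f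
    rw [← K_id, ← K_tensor, PROPData.map_cast K, P.tensor_unit]
  symm_natural f g := by
    obtain ⟨f, rfl⟩ := hK f
    obtain ⟨g, rfl⟩ := hK g
    simp only [← K_comp, ← K_tensor, ← K_symm, P.symm_natural]
  symm_symm a b := by rw [← K_symm, ← K_symm, ← K_comp, P.symm_symm, K_id]
  hexagon a b c := by
    simp only [← K_symm, ← K_id, ← K_tensor]
    rw [PROPData.map_cast K, PROPData.map_cast K, ← K_comp, P.hexagon]

/-! Opposites and quotients. -/

theorem comp_cast (P : PROP.{u}) {a a' b b' c c' : ℕ} (h : a = a') (h' : b = b') (h'' : c = c')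
    (f : P.Hom a b) (g : P.Hom b c) :
    P.comp (P.cast h h' f) (P.cast h' h'' g) = P.cast h h'' (P.comp f g) := by
  subst h h' h''; rfl

theorem cast_id (P : PROP.{u}) {a a' : ℕ} (h : a = a') : P.cast h h (P.id a) = P.id a' := by
  subst h; rfl

theorem cast_cast (P : PROP.{u}) {a a' a'' b b' b'' : ℕ} (h : a = a') (h' : b = b')
    (k : a' = a'') (k' : b' = b'') (f : P.Hom a b) :
    P.cast k k' (P.cast h h' f) = P.cast (h.trans k) (h'.trans k') f := by
  subst h h' k k'; rfl

/-- The opposite of the operations of a prop. -/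
def opData (D : PROPData.{u}) : PROPData.{u} where
  Hom n m := D.Hom m n
  id n := D.id n
  comp f g := D.comp g f
  tensor f g := D.tensor f g
  symm a b := D.symm b a

theorem opData_cast (D : PROPData.{u}) {a a' b b' : ℕ} (h : a = a') (h' : b = b')
    (f : D.Hom b a) : (opData D).cast h h' f = D.cast h' h f := by
  subst h h'; rfl

/-- The opposite prop. -/
def op (P : PROP.{u}) : PROP.{u} where
  toPROPData := opData P.toPROPData
  id_comp f := P.comp_id f
  comp_id f := P.id_comp f
  assoc f g h := (P.assoc h g f).symm
  tensor_id := P.tensor_id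
  tensor_comp f g f' g' := P.tensor_comp g f g' f'
  tensor_assoc f g h := (opData_cast _ _ _ _).trans (P.tensor_assoc f g h)
  unit_tensor f := (opData_cast _ _ _ _).trans (P.unit_tensor f)
  tensor_unit f := (opData_cast _ _ _ _).trans (P.tensor_unit f)
  symm_natural f g := (P.symm_natural g f).symm
  symm_symm a b := P.symm_symm a b
  hexagon a b c := by
    refine (opData_cast P.toPROPData _ _ _).trans (.trans ?_ (congrArg
      (fun t => P.comp (P.tensor (P.id b) (P.symm c a)) t)
      (opData_cast P.toPROPData rfl (Nat.add_assoc b a c)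
        (P.tensor (P.symm b a) (P.id c))).symm))
    have key : ∀ {x y : ℕ} (f : P.Hom x y) (g g' : P.Hom y x), P.comp f g = P.id x →
        P.comp g' f = P.id y → g = g' := by
      intro x y f g g' h h'
      rw [← P.id_comp g, ← h', P.assoc, h, P.comp_id]
    refine key (P.cast (Nat.add_assoc a b c).symm (Nat.add_assoc b c a) (P.symm a (b + c))) _ _
      ?_ ?_
    · refine (P.comp_cast _ _ _ _ _).trans ?_
      exact (congrArg _ (P.symm_symm a (b + c))).trans (P.cast_id _)
    · rw [P.hexagon]
      rw [P.assoc, ← P.assoc (P.cast _ _ _), P.comp_cast (Nat.add_assoc b a c) rfl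
        (Nat.add_assoc b a c), ← P.tensor_comp, P.symm_symm, P.comp_id, P.tensor_id, P.cast_id,
        P.id_comp, ← P.tensor_comp, P.symm_symm, P.comp_id, P.tensor_id]

theorem op_op (P : PROP.{u}) : P.op.op = P := rfl

/-- Laws pass along an injective map compatible with the operations. -/
def ofInjective (P : PROP.{u}) (D : PROPData.{v}) (K : ∀ {n m : ℕ}, D.Hom n m → P.Hom n m)
    (hK : ∀ {n m : ℕ} (f g : D.Hom n m), K f = K g → f = g)
    (K_id : ∀ n, K (D.id n) = P.id n)
    (K_comp : ∀ {n m k} (f : D.Hom n m) (g : D.Hom m k), K (D.comp f g) = P.comp (K f) (K g))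
    (K_tensor : ∀ {a b c d} (f : D.Hom a b) (g : D.Hom c d),
      K (D.tensor f g) = P.tensor (K f) (K g))
    (K_symm : ∀ a b, K (D.symm a b) = P.symm a b) : PROP.{v} where
  toPROPData := D
  id_comp f := hK _ _ <| by rw [K_comp, K_id, P.id_comp]
  comp_id f := hK _ _ <| by rw [K_comp, K_id, P.comp_id]
  assoc f g h := hK _ _ <| by simp only [K_comp, P.assoc]
  tensor_id a b := hK _ _ <| by simp only [K_id, K_tensor, P.tensor_id]
  tensor_comp f g f' g' := hK _ _ <| by simp only [K_comp, K_tensor, P.tensor_comp]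
  tensor_assoc f g h := hK _ _ <| by
    rw [← PROPData.map_cast K]
    simp only [K_tensor, P.tensor_assoc]
  unit_tensor f := hK _ _ <| by rw [← PROPData.map_cast K, K_tensor, K_id, P.unit_tensor]
  tensor_unit f := hK _ _ <| by rw [← PROPData.map_cast K, K_tensor, K_id, P.tensor_unit]
  symm_natural f g := hK _ _ <| by simp only [K_comp, K_tensor, K_symm, P.symm_natural]
  symm_symm a b := hK _ _ <| by simp only [K_comp, K_symm, K_id, P.symm_symm]
  hexagon a b c := hK _ _ <| by
    rw [← PROPData.map_cast K, K_comp, ← PROPData.map_cast K, K_tensor, K_tensor, K_symm, K_symm,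
      K_symm, K_id, K_id, P.hexagon]

/-- The opposite of a morphism of props. -/
def Mor.op {P : PROP.{u}} {Q : PROP.{v}} (F : Mor P Q) : Mor P.op Q.op where
  map f := F.map f
  map_id n := F.map_id n
  map_comp f g := F.map_comp g f
  map_tensor f g := F.map_tensor f g
  map_symm a b := F.map_symm b a

/-- The quotient of `P` by the equivalence relation generated by a relation `r` on arrows, where `r`
is stable under composition and tensor with arbitrary arrows. -/
def quot (P : PROP.{u}) (r : ∀ n m, P.Hom n m → P.Hom n m → Prop)
    (comp_left : ∀ {n m k} (f : P.Hom n m) (g g' : P.Hom m k), r _ _ g g' →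
      r _ _ (P.comp f g) (P.comp f g'))
    (comp_right : ∀ {n m k} (f f' : P.Hom n m) (g : P.Hom m k), r _ _ f f' →
      r _ _ (P.comp f g) (P.comp f' g))
    (tensor_left : ∀ {a b c d} (f : P.Hom a b) (g g' : P.Hom c d), r _ _ g g' →
      r _ _ (P.tensor f g) (P.tensor f g'))
    (tensor_right : ∀ {a b c d} (f f' : P.Hom a b) (g : P.Hom c d), r _ _ f f' →
      r _ _ (P.tensor f g) (P.tensor f' g)) : PROP.{u} :=
  ofSurjective P
    { Hom n m := Quot (r n m)
      id n := Quot.mk _ (P.id n)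
      comp := Quot.map₂ P.comp comp_left comp_right
      tensor := Quot.map₂ P.tensor tensor_left tensor_right
      symm a b := Quot.mk _ (P.symm a b) }
    (fun f => Quot.mk _ f) Quot.exists_rep (fun _ => rfl) (fun _ _ => rfl) (fun _ _ => rfl)
    (fun _ _ => rfl)

/-! Coproducts of props. -/

/-- Formal composites and tensors of arrows of two props. -/
inductive CoprodTerm (P Q : PROP.{u}) : ℕ → ℕ → Type u
  | inl {n m} : P.Hom n m → CoprodTerm P Q n m
  | inr {n m} : Q.Hom n m → CoprodTerm P Q n m
  | comp {n m k} : CoprodTerm P Q n m → CoprodTerm P Q m k → CoprodTerm P Q n k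
  | tensor {a b c d} : CoprodTerm P Q a b → CoprodTerm P Q c d → CoprodTerm P Q (a + c) (b + d)

/-- The operations on formal terms. -/
def coprodTermData (P Q : PROP.{u}) : PROPData.{u} where
  Hom := CoprodTerm P Q
  id n := .inl (P.id n)
  comp := .comp
  tensor := .tensor
  symm a b := .inl (P.symm a b)

/-- The relations that make formal terms into a prop, and both inclusions into morphisms. -/
inductive CoprodRel (P Q : PROP.{u}) : ∀ {n m : ℕ}, CoprodTerm P Q n m → CoprodTerm P Q n m → Prop
  | inl_comp {n m k} (f : P.Hom n m) (g : P.Hom m k) :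
      CoprodRel P Q (.inl (P.comp f g)) (.comp (.inl f) (.inl g))
  | inl_tensor {a b c d} (f : P.Hom a b) (g : P.Hom c d) :
      CoprodRel P Q (.inl (P.tensor f g)) (.tensor (.inl f) (.inl g))
  | inr_id (n) : CoprodRel P Q (.inr (Q.id n)) (.inl (P.id n))
  | inr_comp {n m k} (f : Q.Hom n m) (g : Q.Hom m k) :
      CoprodRel P Q (.inr (Q.comp f g)) (.comp (.inr f) (.inr g))
  | inr_tensor {a b c d} (f : Q.Hom a b) (g : Q.Hom c d) :
      CoprodRel P Q (.inr (Q.tensor f g)) (.tensor (.inr f) (.inr g))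
  | inr_symm (a b) : CoprodRel P Q (.inr (Q.symm a b)) (.inl (P.symm a b))
  | id_comp {n m} (x : CoprodTerm P Q n m) : CoprodRel P Q (.comp (.inl (P.id n)) x) x
  | comp_id {n m} (x : CoprodTerm P Q n m) : CoprodRel P Q (.comp x (.inl (P.id m))) x
  | assoc {n m k l} (x : CoprodTerm P Q n m) (y : CoprodTerm P Q m k) (z : CoprodTerm P Q k l) :
      CoprodRel P Q (.comp (.comp x y) z) (.comp x (.comp y z))
  | tensor_comp {a b c a' b' c'} (x : CoprodTerm P Q a b) (y : CoprodTerm P Q b c)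
      (x' : CoprodTerm P Q a' b') (y' : CoprodTerm P Q b' c') :
      CoprodRel P Q (.tensor (.comp x y) (.comp x' y')) (.comp (.tensor x x') (.tensor y y'))
  | tensor_assoc {a b c a' b' c'} (x : CoprodTerm P Q a a') (y : CoprodTerm P Q b b')
      (z : CoprodTerm P Q c c') :
      CoprodRel P Q ((coprodTermData P Q).cast (Nat.add_assoc a b c) (Nat.add_assoc a' b' c')
        (.tensor (.tensor x y) z)) (.tensor x (.tensor y z))
  | unit_tensor {a b} (x : CoprodTerm P Q a b) :
      CoprodRel P Q ((coprodTermData P Q).cast (Nat.zero_add a) (Nat.zero_add b)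
        (.tensor (.inl (P.id 0)) x)) x
  | tensor_unit {a b} (x : CoprodTerm P Q a b) :
      CoprodRel P Q ((coprodTermData P Q).cast (Nat.add_zero a) (Nat.add_zero b)
        (.tensor x (.inl (P.id 0)))) x
  | symm_natural {a b c d} (x : CoprodTerm P Q a b) (y : CoprodTerm P Q c d) :
      CoprodRel P Q (.comp (.tensor x y) (.inl (P.symm b d))) (.comp (.inl (P.symm a c)) (.tensor y x))
  | comp_left {n m k} (x : CoprodTerm P Q n m) (y y' : CoprodTerm P Q m k) :
      CoprodRel P Q y y' → CoprodRel P Q (.comp x y) (.comp x y')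
  | comp_right {n m k} (x x' : CoprodTerm P Q n m) (y : CoprodTerm P Q m k) :
      CoprodRel P Q x x' → CoprodRel P Q (.comp x y) (.comp x' y)
  | tensor_left {a b c d} (x : CoprodTerm P Q a b) (y y' : CoprodTerm P Q c d) :
      CoprodRel P Q y y' → CoprodRel P Q (.tensor x y) (.tensor x y')
  | tensor_right {a b c d} (x x' : CoprodTerm P Q a b) (y : CoprodTerm P Q c d) :
      CoprodRel P Q x x' → CoprodRel P Q (.tensor x y) (.tensor x' y)

/-- The operations of the coproduct of two props. -/
def coprodData (P Q : PROP.{u}) : PROPData.{u} where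
  Hom n m := Quot (CoprodRel P Q (n := n) (m := m))
  id n := Quot.mk _ (.inl (P.id n))
  comp := Quot.map₂ .comp .comp_left .comp_right
  tensor := Quot.map₂ .tensor .tensor_left .tensor_right
  symm a b := Quot.mk _ (.inl (P.symm a b))

theorem coprodData_cast (P Q : PROP.{u}) {a a' b b' : ℕ} (h : a = a') (h' : b = b')
    (x : CoprodTerm P Q a b) :
    (coprodData P Q).cast h h' (Quot.mk _ x) = Quot.mk _ ((coprodTermData P Q).cast h h' x) := by
  subst h h'; rfl

theorem coprodTermData_cast_inl (P Q : PROP.{u}) {a a' b b' : ℕ} (h : a = a') (h' : b = b')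
    (f : P.Hom a b) :
    (coprodTermData P Q).cast h h' (.inl f) = .inl (P.cast h h' f) := by
  subst h h'; rfl

/-- The coproduct of two props. -/
def sum (P Q : PROP.{u}) : PROP.{u} where
  toPROPData := coprodData P Q
  id_comp := by rintro n m ⟨x⟩; exact Quot.sound (.id_comp x)
  comp_id := by rintro n m ⟨x⟩; exact Quot.sound (.comp_id x)
  assoc := by rintro n m k l ⟨x⟩ ⟨y⟩ ⟨z⟩; exact Quot.sound (.assoc x y z)
  tensor_id a b := by
    refine (Quot.sound (.inl_tensor (P.id a) (P.id b))).symm.trans ?_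
    rw [P.tensor_id]; rfl
  tensor_comp := by
    rintro a b c a' b' c' ⟨x⟩ ⟨y⟩ ⟨x'⟩ ⟨y'⟩
    exact Quot.sound (.tensor_comp x y x' y')
  tensor_assoc := by
    rintro a b c a' b' c' ⟨x⟩ ⟨y⟩ ⟨z⟩
    exact (coprodData_cast P Q _ _ _).trans (Quot.sound (.tensor_assoc x y z))
  unit_tensor := by
    rintro a b ⟨x⟩
    exact (coprodData_cast P Q _ _ _).trans (Quot.sound (.unit_tensor x))
  tensor_unit := by
    rintro a b ⟨x⟩
    exact (coprodData_cast P Q _ _ _).trans (Quot.sound (.tensor_unit x))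
  symm_natural := by
    rintro a b c d ⟨x⟩ ⟨y⟩
    exact Quot.sound (.symm_natural x y)
  symm_symm a b := by
    refine (Quot.sound (.inl_comp (P.symm a b) (P.symm b a))).symm.trans ?_
    rw [P.symm_symm]; rfl
  hexagon a b c := by
    have e : (coprodData P Q).tensor ((coprodData P Q).symm a b) ((coprodData P Q).id c) =
        Quot.mk _ (.inl (P.tensor (P.symm a b) (P.id c))) :=
      (Quot.sound (.inl_tensor _ _)).symm
    have e' : (coprodData P Q).tensor ((coprodData P Q).id b) ((coprodData P Q).symm a c) =
        Quot.mk _ (.inl (P.tensor (P.id b) (P.symm a c))) :=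
      (Quot.sound (.inl_tensor _ _)).symm
    rw [e, e', coprodData_cast, coprodTermData_cast_inl]
    refine (coprodData_cast P Q _ _ _).trans ?_
    rw [coprodTermData_cast_inl, P.hexagon]
    exact Quot.sound (.inl_comp _ _)

/-- The first inclusion into the coproduct. -/
def sumInl (P Q : PROP.{u}) : P ⟶ sum P Q where
  map f := Quot.mk _ (.inl f)
  map_id _ := rfl
  map_comp f g := Quot.sound (.inl_comp f g)
  map_tensor f g := Quot.sound (.inl_tensor f g)
  map_symm _ _ := rfl

/-- The second inclusion into the coproduct. -/
def sumInr (P Q : PROP.{u}) : Q ⟶ sum P Q where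
  map f := Quot.mk _ (.inr f)
  map_id n := Quot.sound (.inr_id n)
  map_comp f g := Quot.sound (.inr_comp f g)
  map_tensor f g := Quot.sound (.inr_tensor f g)
  map_symm a b := Quot.sound (.inr_symm a b)

/-- Evaluation of formal terms in a prop. -/
def CoprodTerm.eval {P Q R : PROP.{u}} (F : Mor P R) (G : Mor Q R) :
    ∀ {n m : ℕ}, CoprodTerm P Q n m → R.Hom n m
  | _, _, .inl f => F.map f
  | _, _, .inr f => G.map f
  | _, _, .comp x y => R.comp (x.eval F G) (y.eval F G)
  | _, _, .tensor x y => R.tensor (x.eval F G) (y.eval F G)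

theorem CoprodTerm.eval_rel {P Q R : PROP.{u}} (F : Mor P R) (G : Mor Q R) {n m : ℕ}
    {x y : CoprodTerm P Q n m} (h : CoprodRel P Q x y) : x.eval F G = y.eval F G := by
  have hc := @PROPData.map_cast (coprodTermData P Q) R.toPROPData
    (fun {n m} (x : CoprodTerm P Q n m) => x.eval F G)
  induction h with
  | inl_comp f g => exact F.map_comp f g
  | inl_tensor f g => exact F.map_tensor f g
  | inr_id n => exact (G.map_id n).trans (F.map_id n).symm
  | inr_comp f g => exact G.map_comp f g
  | inr_tensor f g => exact G.map_tensor f g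
  | inr_symm a b => exact (G.map_symm a b).trans (F.map_symm a b).symm
  | id_comp x => simp only [eval, F.map_id, R.id_comp]
  | comp_id x => simp only [eval, F.map_id, R.comp_id]
  | assoc x y z => simp only [eval, R.assoc]
  | tensor_comp x y x' y' => simp only [eval, R.tensor_comp]
  | tensor_assoc x y z => refine (hc _ _ _).symm.trans ?_; simp only [eval, R.tensor_assoc]
  | unit_tensor x => refine (hc _ _ _).symm.trans ?_; simp only [eval, F.map_id, R.unit_tensor]
  | tensor_unit x => refine (hc _ _ _).symm.trans ?_; simp only [eval, F.map_id, R.tensor_unit]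
  | symm_natural x y => simp only [eval, F.map_symm, R.symm_natural]
  | comp_left x y y' _ ih => simp only [eval, ih]
  | comp_right x x' y _ ih => simp only [eval, ih]
  | tensor_left x y y' _ ih => simp only [eval, ih]
  | tensor_right x x' y _ ih => simp only [eval, ih]

/-- The morphism out of the coproduct given by two morphisms of props. -/
def sumDesc {P Q R : PROP.{u}} (F : P ⟶ R) (G : Q ⟶ R) : sum P Q ⟶ R where
  map := Quot.lift (CoprodTerm.eval F G) (fun _ _ h => CoprodTerm.eval_rel F G h)
  map_id n := Mor.map_id F n
  map_comp := by rintro n m k ⟨x⟩ ⟨y⟩; rfl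
  map_tensor := by rintro a b c d ⟨x⟩ ⟨y⟩; rfl
  map_symm a b := Mor.map_symm F a b

theorem sum_hom_ext {P Q R : PROP.{u}} {F G : sum P Q ⟶ R}
    (hl : sumInl P Q ≫ F = sumInl P Q ≫ G) (hr : sumInr P Q ≫ F = sumInr P Q ≫ G) : F = G := by
  refine Mor.ext ?_
  funext n m x
  induction x using Quot.ind with
  | mk x =>
  induction x with
  | inl f => exact congrArg (fun H : P ⟶ R => Mor.map H f) hl
  | inr f => exact congrArg (fun H : Q ⟶ R => Mor.map H f) hr
  | comp x y ihx ihy =>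
    refine (Mor.map_comp F (Quot.mk _ x) (Quot.mk _ y)).trans (.trans ?_
      (Mor.map_comp G (Quot.mk _ x) (Quot.mk _ y)).symm)
    rw [ihx, ihy]
  | tensor x y ihx ihy =>
    refine (Mor.map_tensor F (Quot.mk _ x) (Quot.mk _ y)).trans (.trans ?_
      (Mor.map_tensor G (Quot.mk _ x) (Quot.mk _ y)).symm)
    rw [ihx, ihy]

/-- The cofan of inclusions is a coproduct in the category of props. -/
def sumIsColimit (P Q : PROP.{u}) : IsColimit (BinaryCofan.mk (sumInl P Q) (sumInr P Q)) :=
  BinaryCofan.isColimitMk (fun s => sumDesc s.inl s.inr) (fun _ => rfl) (fun _ => rfl)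
    (fun _ _ hl hr => sum_hom_ext hl hr)

instance : HasBinaryCoproducts PROP.{u} :=
  have (P Q : PROP.{u}) : HasColimit (pair P Q) := ⟨⟨⟨_, sumIsColimit P Q⟩⟩⟩
  hasBinaryCoproducts_of_hasColimit_pair _

/-! Cospans and spans. -/

/-- The prop `C` has pushouts, and its monoidal product preserves them. -/
class MonoidalPushouts (C : PROP.{u}) : Prop where
  hasPushouts : HasPushouts C.Obj
  isPushout_tensor : ∀ {z x y p z' x' y' p' : ℕ}
    {f : C.Hom z x} {g : C.Hom z y} {h : C.Hom x p} {i : C.Hom y p}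
    {f' : C.Hom z' x'} {g' : C.Hom z' y'} {h' : C.Hom x' p'} {i' : C.Hom y' p'},
    IsPushout (C.ar f) (C.ar g) (C.ar h) (C.ar i) →
    IsPushout (C.ar f') (C.ar g') (C.ar h') (C.ar i') →
    IsPushout (C.ar (C.tensor f f')) (C.ar (C.tensor g g')) (C.ar (C.tensor h h'))
      (C.ar (C.tensor i i'))

attribute [instance] MonoidalPushouts.hasPushouts

/-- A cospan `n → apex ← m` in a prop. -/
structure CospanRep (C : PROP.{u}) (n m : ℕ) where
  apex : ℕ
  left : C.Hom n apex
  right : C.Hom m apex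

/-- Two cospans are isomorphic if there is an isomorphism of apices compatible with the legs. -/
instance cospanSetoid (C : PROP.{u}) (n m : ℕ) : Setoid (CospanRep C n m) where
  r x y := ∃ e : C.ob x.apex ≅ C.ob y.apex,
    C.ar x.left ≫ e.hom = C.ar y.left ∧ C.ar x.right ≫ e.hom = C.ar y.right
  iseqv :=
    { refl := fun x => ⟨Iso.refl _, Category.comp_id _, Category.comp_id _⟩
      symm := by
        rintro x y ⟨e, h, h'⟩
        exact ⟨e.symm, by simp [← h], by simp [← h']⟩
      trans := by
        rintro x y z ⟨e, h, h'⟩ ⟨e', k, k'⟩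
        exact ⟨e ≪≫ e', by simp [← k, ← h], by simp [← k', ← h']⟩ }

/-- Isomorphism classes of cospans `n → · ← m`. -/
def CospanHom (C : PROP.{u}) (n m : ℕ) : Type u := Quotient (cospanSetoid C n m)

/-- The isomorphism class of the cospan `n → k ← m` with legs `f` and `g`. -/
def cospanMk {C : PROP.{u}} {n m k : ℕ} (f : C.Hom n k) (g : C.Hom m k) : CospanHom C n m :=
  Quotient.mk _ ⟨k, f, g⟩

theorem cospanMk_ind {C : PROP.{u}} {n m : ℕ} {p : CospanHom C n m → Prop}
    (h : ∀ (k : ℕ) (f : C.Hom n k) (g : C.Hom m k), p (cospanMk f g)) (x : CospanHom C n m) :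
    p x := Quotient.ind (fun x => h x.apex x.left x.right) x

theorem cospanMk_eq_iff {C : PROP.{u}} {n m k k' : ℕ} {f : C.Hom n k} {g : C.Hom m k}
    {f' : C.Hom n k'} {g' : C.Hom m k'} : cospanMk f g = cospanMk f' g' ↔
      ∃ e : C.ob k ≅ C.ob k', C.ar f ≫ e.hom = C.ar f' ∧ C.ar g ≫ e.hom = C.ar g' :=
  Quotient.eq (r := cospanSetoid C n m)

/-- Composition of cospans by pushout. -/
noncomputable def cospanComp {C : PROP.{u}} [MonoidalPushouts C] {n m k : ℕ}
    (x : CospanRep C n m) (y : CospanRep C m k) : CospanRep C n k where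
  apex := (pushout (C.ar x.right) (C.ar y.left)).n
  left := C.ar x.left ≫ pushout.inl (C.ar x.right) (C.ar y.left)
  right := C.ar y.right ≫ pushout.inr (C.ar x.right) (C.ar y.left)

theorem cospanComp_eq {C : PROP.{u}} [MonoidalPushouts C] {n m k : ℕ}
    (x : CospanRep C n m) (y : CospanRep C m k) {p : ℕ} (i : C.Hom x.apex p) (j : C.Hom y.apex p)
    (h : IsPushout (C.ar x.right) (C.ar y.left) (C.ar i) (C.ar j)) :
    (Quotient.mk _ (cospanComp x y) : CospanHom C n k) =
      cospanMk (C.comp x.left i) (C.comp y.right j) := by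
  refine Quotient.sound ⟨(IsPushout.of_hasPushout (C.ar x.right) (C.ar y.left)).isoIsPushout _ _ h,
    ?_, ?_⟩
  · change (C.ar x.left ≫ pushout.inl (C.ar x.right) (C.ar y.left)) ≫ _ = C.ar x.left ≫ C.ar i
    rw [Category.assoc, IsPushout.inl_isoIsPushout_hom]
  · change (C.ar y.right ≫ pushout.inr (C.ar x.right) (C.ar y.left)) ≫ _ = C.ar y.right ≫ C.ar j
    rw [Category.assoc, IsPushout.inr_isoIsPushout_hom]

/-- The tensor of two isomorphisms. -/
def tensorIso {C : PROP.{u}} {a b c d : ℕ} (e : C.ob a ≅ C.ob b) (e' : C.ob c ≅ C.ob d) :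
    C.ob (a + c) ≅ C.ob (b + d) where
  hom := C.tensor e.hom e'.hom
  inv := C.tensor e.inv e'.inv
  hom_inv_id := by
    refine (C.tensor_comp _ _ _ _).symm.trans ?_
    exact (congrArg₂ C.tensor e.hom_inv_id e'.hom_inv_id).trans (C.tensor_id _ _)
  inv_hom_id := by
    refine (C.tensor_comp _ _ _ _).symm.trans ?_
    exact (congrArg₂ C.tensor e.inv_hom_id e'.inv_hom_id).trans (C.tensor_id _ _)

/-- The symmetry as an isomorphism. -/
def symmIso (C : PROP.{u}) (a b : ℕ) : C.ob (a + b) ≅ C.ob (b + a) where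
  hom := C.symm a b
  inv := C.symm b a
  hom_inv_id := C.symm_symm a b
  inv_hom_id := C.symm_symm b a

/-- The operations on isomorphism classes of cospans: composition by pushout, componentwise
tensor, and the symmetries of `C` as cospans. -/
noncomputable def cospanData (C : PROP.{u}) [MonoidalPushouts C] : PROPData.{u} where
  Hom n m := CospanHom C n m
  id n := cospanMk (C.id n) (C.id n)
  comp := Quotient.map₂ cospanComp <| by
    rintro x x' ⟨e, h, h'⟩ y y' ⟨d, k, k'⟩
    refine Quotient.exact ((cospanComp_eq x y
      (e.hom ≫ pushout.inl (C.ar x'.right) (C.ar y'.left) :)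
      (d.hom ≫ pushout.inr (C.ar x'.right) (C.ar y'.left) :) ?_).trans ?_)
    · exact (IsPushout.of_hasPushout (C.ar x'.right) (C.ar y'.left)).of_iso (Iso.refl _) e.symm
        d.symm (Iso.refl _) (by simp [← h']) (by simp [← k]) (by simp [ar]) (by simp [ar])
    · have hl : C.comp x.left (e.hom ≫ pushout.inl (C.ar x'.right) (C.ar y'.left) :) =
          C.ar x'.left ≫ pushout.inl (C.ar x'.right) (C.ar y'.left) := by
        rw [← h, Category.assoc]; rfl
      have hr : C.comp y.right (d.hom ≫ pushout.inr (C.ar x'.right) (C.ar y'.left) :) =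
          C.ar y'.right ≫ pushout.inr (C.ar x'.right) (C.ar y'.left) := by
        rw [← k', Category.assoc]; rfl
      rw [hl, hr]; rfl
  tensor := Quotient.map₂ (fun x y => ⟨x.apex + y.apex, C.tensor x.left y.left,
      C.tensor x.right y.right⟩) <| by
    rintro x x' ⟨e, h, h'⟩ y y' ⟨d, k, k'⟩
    exact ⟨tensorIso e d,
      (C.tensor_comp _ _ _ _).symm.trans (congrArg₂ C.tensor h k),
      (C.tensor_comp _ _ _ _).symm.trans (congrArg₂ C.tensor h' k')⟩
  symm a b := cospanMk (C.symm a b) (C.id (b + a))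

section

variable {C : PROP.{u}} [MonoidalPushouts C]

theorem cospanData_comp_mk {n m k x y p : ℕ} (f : C.Hom n x) (g : C.Hom m x) (h : C.Hom m y)
    (l : C.Hom k y) (i : C.Hom x p) (j : C.Hom y p)
    (hp : IsPushout (C.ar g) (C.ar h) (C.ar i) (C.ar j)) :
    (cospanData C).comp (cospanMk f g) (cospanMk h l) = cospanMk (C.comp f i) (C.comp l j) :=
  cospanComp_eq ⟨x, f, g⟩ ⟨y, h, l⟩ i j hp

theorem exists_isPushout {n x y : ℕ} (f : C.Hom n x) (g : C.Hom n y) :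
    ∃ (p : ℕ) (i : C.Hom x p) (j : C.Hom y p),
      IsPushout (C.ar f) (C.ar g) (C.ar i) (C.ar j) :=
  ⟨_, _, _, IsPushout.of_hasPushout (C.ar f) (C.ar g)⟩

theorem cospanData_tensor_mk {a b c d x y : ℕ} (f : C.Hom a x) (g : C.Hom b x) (h : C.Hom c y)
    (l : C.Hom d y) : (cospanData C).tensor (cospanMk f g) (cospanMk h l) =
      cospanMk (C.tensor f h) (C.tensor g l) := rfl

theorem cospanData_cast_mk {a a' b b' x x' : ℕ} (h : a = a') (h' : b = b') (h'' : x = x')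
    (f : C.Hom a x) (g : C.Hom b x) : (cospanData C).cast h h' (cospanMk f g) =
      cospanMk (C.cast h h'' f) (C.cast h' h'' g) := by
  subst h h' h''; rfl

theorem cospanData_comp_hom {n m k x : ℕ} (f : C.Hom n m) (g : C.Hom m x) (l : C.Hom k x) :
    (cospanData C).comp (cospanMk f (C.id m)) (cospanMk g l) = cospanMk (C.comp f g) l := by
  refine (cospanData_comp_mk _ _ _ _ g (C.id x) ?_).trans (by rw [C.comp_id])
  exact IsPushout.of_id_fst

theorem cospanData_comp_op {n m k x : ℕ} (f : C.Hom n x) (g : C.Hom m x) (l : C.Hom k m) :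
    (cospanData C).comp (cospanMk f g) (cospanMk (C.id m) l) = cospanMk f (C.comp l g) := by
  refine (cospanData_comp_mk _ _ _ _ (C.id x) g ?_).trans (by rw [C.comp_id])
  exact IsPushout.of_id_snd

end

/-- The prop `Cospan(C)` of isomorphism classes of cospans in `C`. -/
noncomputable def cospan (C : PROP.{u}) [MonoidalPushouts C] : PROP.{u} where
  toPROPData := cospanData C
  id_comp x := by
    induction x using cospanMk_ind with
    | h k f g => exact (cospanData_comp_hom _ _ _).trans (by rw [C.id_comp])
  comp_id x := by
    induction x using cospanMk_ind with
    | h k f g => exact (cospanData_comp_op _ _ _).trans (by rw [C.id_comp])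
  assoc x y z := by
    induction x using cospanMk_ind with | h a f f' =>
    induction y using cospanMk_ind with | h b g g' =>
    induction z using cospanMk_ind with | h c h h' =>
    obtain ⟨p, i, j, P⟩ := exists_isPushout f' g
    obtain ⟨q, k, l, Q⟩ := exists_isPushout g' h
    obtain ⟨r, s, t, R⟩ := exists_isPushout j k
    rw [cospanData_comp_mk _ _ _ _ _ _ P, cospanData_comp_mk _ _ _ _ _ _ Q]
    refine (cospanData_comp_mk _ _ _ _ s (C.comp l t)
      (Q.flip.paste_vert R.flip).flip).trans ?_
    refine Eq.trans ?_ (cospanData_comp_mk _ _ _ _ (C.comp i s) t (P.paste_vert R)).symm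
    exact congrArg₂ cospanMk (C.assoc _ _ _) (C.assoc _ _ _).symm
  tensor_id a b := by
    refine (cospanData_tensor_mk _ _ _ _).trans ?_
    rw [C.tensor_id]; rfl
  tensor_comp x y x' y' := by
    induction x using cospanMk_ind with | h a f f' =>
    induction y using cospanMk_ind with | h b g g' =>
    induction x' using cospanMk_ind with | h c h h' =>
    induction y' using cospanMk_ind with | h d k k' =>
    obtain ⟨p, i, j, P⟩ := exists_isPushout f' g
    obtain ⟨q, i', j', Q⟩ := exists_isPushout h' k
    rw [cospanData_comp_mk _ _ _ _ _ _ P, cospanData_comp_mk _ _ _ _ _ _ Q]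
    refine Eq.trans ?_ (cospanData_comp_mk _ _ _ _ _ _
      (MonoidalPushouts.isPushout_tensor P Q)).symm
    exact congrArg₂ cospanMk (C.tensor_comp _ _ _ _) (C.tensor_comp _ _ _ _)
  tensor_assoc x y z := by
    induction x using cospanMk_ind with | h a f f' =>
    induction y using cospanMk_ind with | h b g g' =>
    induction z using cospanMk_ind with | h c h h' =>
    refine (cospanData_cast_mk _ _ (Nat.add_assoc a b c) _ _).trans ?_
    rw [C.tensor_assoc, C.tensor_assoc]; rfl
  unit_tensor x := by
    induction x using cospanMk_ind with | h a f f' =>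
    refine (cospanData_cast_mk _ _ (Nat.zero_add a) _ _).trans ?_
    rw [C.unit_tensor, C.unit_tensor]
  tensor_unit x := by
    induction x using cospanMk_ind with | h a f f' =>
    refine (cospanData_cast_mk _ _ (Nat.add_zero a) _ _).trans ?_
    rw [C.tensor_unit, C.tensor_unit]
  symm_natural {a b c d} x y := by
    induction x using cospanMk_ind with | h k f f' =>
    induction y using cospanMk_ind with | h l g g' =>
    refine Eq.trans ?_ (cospanData_comp_hom (C.symm a c) (C.tensor g f) (C.tensor g' f')).symm
    refine (cospanData_comp_mk (C.tensor f g) (C.tensor f' g') (C.symm b d) (C.id (d + b))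
      (C.symm k l) (C.tensor g' f') ?_).trans ?_
    · have : IsIso (C.ar (C.symm b d)) := (symmIso C b d).isIso_hom
      have : IsIso (C.ar (C.symm k l)) := (symmIso C k l).isIso_hom
      exact IsPushout.of_vert_isIso ⟨C.symm_natural _ _⟩
    · rw [C.id_comp, C.symm_natural]
  symm_symm a b := by
    refine (cospanData_comp_hom _ _ _).trans ?_
    rw [C.symm_symm]; rfl
  hexagon a b c := by
    have e : (cospanData C).tensor ((cospanData C).symm a b) ((cospanData C).id c) =
        cospanMk (C.tensor (C.symm a b) (C.id c)) (C.id (b + a + c)) :=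
      (cospanData_tensor_mk _ _ _ _).trans (by rw [C.tensor_id])
    have e' : (cospanData C).tensor ((cospanData C).id b) ((cospanData C).symm a c) =
        cospanMk (C.tensor (C.id b) (C.symm a c)) (C.id (b + (c + a))) :=
      (cospanData_tensor_mk _ _ _ _).trans (by rw [C.tensor_id])
    rw [e, e', cospanData_cast_mk _ _ (Nat.add_assoc b a c), C.cast_id, cospanData_comp_hom]
    refine (cospanData_cast_mk _ _ (Nat.add_assoc b c a) _ _).trans ?_
    rw [C.cast_id, C.hexagon]

/-- The morphism `C → Cospan(C)` that maps `f` to the cospan with legs `f` and the identity. -/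
noncomputable def cospanOfHom (C : PROP.{u}) [MonoidalPushouts C] : C ⟶ C.cospan where
  map {_ m} f := cospanMk f (C.id m)
  map_id _ := rfl
  map_comp f g := (cospanData_comp_hom f g _).symm
  map_tensor f g := by
    refine Eq.trans ?_ (cospanData_tensor_mk _ _ _ _).symm
    rw [C.tensor_id]
  map_symm _ _ := rfl

/-- The morphism `Cᵒᵖ → Cospan(C)` that maps `g` to the cospan with legs the identity and `g`. -/
noncomputable def cospanOfOp (C : PROP.{u}) [MonoidalPushouts C] : C.op ⟶ C.cospan where
  map {n _} g := cospanMk (C.id n) g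
  map_id _ := rfl
  map_comp {n m k} f g :=
    (cospanData_comp_op (C := C) (n := n) (m := m) (k := k) (x := n) (C.id n) f g).symm
  map_tensor {a b c d} f g := by
    refine Eq.trans ?_ (cospanData_tensor_mk (C := C) (C.id a) f (C.id c) g).symm
    rw [C.tensor_id]; rfl
  map_symm a b := cospanMk_eq_iff.2 ⟨symmIso C a b, C.id_comp _, C.symm_symm b a⟩

/-- The prop `Span(A)` of isomorphism classes of spans in `A`, for `A` with pullbacks preserved by
the monoidal product. A span in `A` is a cospan in the opposite of `A`, and spans are composed by
pullback in `A`, that is, by pushout in the opposite of `A`. -/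
noncomputable abbrev span (A : PROP.{u}) [MonoidalPushouts A.op] : PROP.{u} := A.op.cospan

/-- The isomorphism class of the span `n ← k → m` with legs `f` and `g`. -/
def spanMk {A : PROP.{u}} [MonoidalPushouts A.op] {n m k : ℕ} (f : A.Hom k n) (g : A.Hom k m) :
    A.span.Hom n m :=
  cospanMk (C := A.op) f g

/-- The morphism `A → Span(A)` that maps `g` to the span with legs the identity and `g`. -/
noncomputable def spanOfHom (A : PROP.{u}) [MonoidalPushouts A.op] : A ⟶ A.span :=
  cospanOfOp A.op

/-- The morphism `Aᵒᵖ → Span(A)` that maps `f` to the span with legs `f` and the identity. -/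
noncomputable def spanOfOp (A : PROP.{u}) [MonoidalPushouts A.op] : A.op ⟶ A.span :=
  cospanOfHom A.op

/-! Corelations. -/

/-- A factorisation system on a category. -/
structure FactorisationSystem (C : Type v) [Category.{u} C] where
  E : MorphismProperty C
  M : MorphismProperty C
  E_mul : E.IsMultiplicative
  M_mul : M.IsMultiplicative
  E_iso : ∀ {X Y : C} (f : X ⟶ Y), IsIso f → E f
  M_iso : ∀ {X Y : C} (f : X ⟶ Y), IsIso f → M f
  exists_fac : ∀ {X Y : C} (f : X ⟶ Y), ∃ (Z : C) (e : X ⟶ Z) (m : Z ⟶ Y), E e ∧ M m ∧ e ≫ m = f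
  existsUnique_diag : ∀ {X Y Z X' Y' Z' : C} (e : X ⟶ Z) (m : Z ⟶ Y) (e' : X' ⟶ Z') (m' : Z' ⟶ Y'),
    E e → M m → E e' → M m' → ∀ (u : X ⟶ X') (v : Y ⟶ Y'), (e ≫ m) ≫ v = u ≫ e' ≫ m' →
      ∃! s : Z ⟶ Z', e ≫ s = u ≫ e' ∧ s ≫ m' = m ≫ v

/-- A factorisation system on a prop that is costable and whose right class is closed under the
monoidal product. -/
structure CostableSystem (C : PROP.{u}) extends FactorisationSystem C.Obj where
  costable : M.IsStableUnderCobaseChange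
  M_tensor : ∀ {a b c d : ℕ} (f : C.Hom a b) (g : C.Hom c d), M (C.ar f) → M (C.ar g) →
    M (C.ar (C.tensor f g))

/-- The basic relation between cospans that generates equality of corelations: there is a map of
cospans from one to the other whose map of apices lies in the right class. -/
def corelRel {C : PROP.{u}} (S : CostableSystem C) (n m : ℕ) (x y : CospanHom C n m) : Prop :=
  ∃ (k l : ℕ) (f : C.Hom n k) (g : C.Hom m k) (i : C.Hom k l), S.M (C.ar i) ∧
    x = cospanMk f g ∧ y = cospanMk (C.comp f i) (C.comp g i)

/-- The prop `Corel(C)` of corelations: cospans modulo the equivalence relation generated by maps of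
cospans in the right class of the factorisation system. -/
noncomputable def corel {C : PROP.{u}} [MonoidalPushouts C] (S : CostableSystem C) : PROP.{u} :=
  C.cospan.quot (corelRel S)
    (by
      rintro n m k x _ _ ⟨a, b, f, g, i, hi, rfl, rfl⟩
      induction x using cospanMk_ind with | h c h h' =>
      obtain ⟨p, j, j', P⟩ := exists_isPushout h' f
      obtain ⟨q, r, s, Q⟩ := exists_isPushout j' i
      refine ⟨_, _, C.comp h j, C.comp g j', r, S.costable.of_isPushout Q hi,
        cospanData_comp_mk _ _ _ _ _ _ P, ?_⟩
      refine (cospanData_comp_mk _ _ _ _ (C.comp j r) s (P.paste_vert Q)).trans ?_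
      rw [C.assoc, C.assoc, C.assoc]
      exact congrArg (fun t => cospanMk _ (C.comp g t)) Q.w.symm)
    (by
      rintro n m k _ _ x ⟨a, b, f, g, i, hi, rfl, rfl⟩
      induction x using cospanMk_ind with | h c h h' =>
      obtain ⟨p, j, j', P⟩ := exists_isPushout g h
      obtain ⟨q, r, s, Q⟩ := exists_isPushout j i
      refine ⟨_, _, C.comp f j, C.comp h' j', r, S.costable.of_isPushout Q hi,
        cospanData_comp_mk _ _ _ _ _ _ P, ?_⟩
      refine (cospanData_comp_mk _ _ _ _ s (C.comp j' r) (P.flip.paste_vert Q).flip).trans ?_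
      rw [C.assoc, C.assoc, C.assoc]
      exact congrArg (fun t => cospanMk (C.comp f t) _) Q.w.symm)
    (by
      rintro n m k l x _ _ ⟨a, b, f, g, i, hi, rfl, rfl⟩
      induction x using cospanMk_ind with | h c h h' =>
      refine ⟨_, _, C.tensor h f, C.tensor h' g, C.tensor (C.id c) i,
        S.M_tensor _ _ (S.M_iso _ (inferInstanceAs (IsIso (𝟙 (C.ob c))))) hi, rfl, ?_⟩
      rw [← C.tensor_comp, ← C.tensor_comp, C.comp_id, C.comp_id]; rfl)
    (by
      rintro n m k l _ _ x ⟨a, b, f, g, i, hi, rfl, rfl⟩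
      induction x using cospanMk_ind with | h c h h' =>
      refine ⟨_, _, C.tensor f h, C.tensor g h', C.tensor i (C.id c),
        S.M_tensor _ _ hi (S.M_iso _ (inferInstanceAs (IsIso (𝟙 (C.ob c))))), rfl, ?_⟩
      rw [← C.tensor_comp, ← C.tensor_comp, C.comp_id, C.comp_id]; rfl)

/-- The corelation represented by the cospan with legs `f` and `g`. -/
noncomputable def corelMk {C : PROP.{u}} [MonoidalPushouts C] (S : CostableSystem C) {n m k : ℕ}
    (f : C.Hom n k) (g : C.Hom m k) : (corel S).Hom n m :=
  Quot.mk _ (cospanMk f g)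

/-- The morphism `Cospan(C) → Corel(C)` that maps a cospan to the corelation it represents. -/
noncomputable def cospanToCorel {C : PROP.{u}} [MonoidalPushouts C] (S : CostableSystem C) :
    C.cospan ⟶ corel S where
  map x := Quot.mk _ x
  map_id _ := rfl
  map_comp _ _ := rfl
  map_tensor _ _ := rfl
  map_symm _ _ := rfl

/-! The prop of functions and its sub-prop of injections. -/

/-- The disjoint union of two functions between finite ordinals. -/
def finTensor {a b c d : ℕ} (f : Fin a → Fin b) (g : Fin c → Fin d) : Fin (a + c) → Fin (b + d) :=
  Fin.addCases (fun i => Fin.castAdd d (f i)) (fun j => Fin.natAdd b (g j))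

/-- The exchange of two blocks. -/
def finSymm (a b : ℕ) : Fin (a + b) → Fin (b + a) :=
  Fin.addCases (fun i => Fin.natAdd b i) (fun j => Fin.castAdd a j)

theorem fin_cases {a b : ℕ} {p : Fin (a + b) → Prop} (hl : ∀ i, p (Fin.castAdd b i))
    (hr : ∀ j, p (Fin.natAdd a j)) (x : Fin (a + b)) : p x := Fin.addCases hl hr x

@[simp] theorem finTensor_left {a b c d : ℕ} (f : Fin a → Fin b) (g : Fin c → Fin d) (i : Fin a) :
    finTensor f g (Fin.castAdd c i) = Fin.castAdd d (f i) := by simp [finTensor]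

@[simp] theorem finTensor_right {a b c d : ℕ} (f : Fin a → Fin b) (g : Fin c → Fin d)
    (i : Fin c) : finTensor f g (Fin.natAdd a i) = Fin.natAdd b (g i) := by simp [finTensor]

@[simp] theorem finSymm_left {a b : ℕ} (i : Fin a) :
    finSymm a b (Fin.castAdd b i) = Fin.natAdd b i := by simp [finSymm]

@[simp] theorem finSymm_right {a b : ℕ} (i : Fin b) :
    finSymm a b (Fin.natAdd a i) = Fin.castAdd a i := by simp [finSymm]

theorem finTensor_comp {a b c a' b' c' : ℕ} (f : Fin a → Fin b) (g : Fin b → Fin c)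
    (f' : Fin a' → Fin b') (g' : Fin b' → Fin c') (x : Fin (a + a')) :
    finTensor (fun i => g (f i)) (fun i => g' (f' i)) x = finTensor g g' (finTensor f f' x) := by
  induction x using fin_cases <;> simp

theorem finTensor_id {a b : ℕ} (x : Fin (a + b)) :
    finTensor (fun i : Fin a => i) (fun i : Fin b => i) x = x := by
  induction x using fin_cases <;> simp

theorem finTensor_assoc {a b c a' b' c' : ℕ} (f : Fin a → Fin a') (g : Fin b → Fin b')
    (h : Fin c → Fin c') (x : Fin (a + (b + c))) :
    Fin.cast (Nat.add_assoc a' b' c') (finTensor (finTensor f g) h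
      (Fin.cast (Nat.add_assoc a b c).symm x)) = finTensor f (finTensor g h) x := by
  induction x using fin_cases with
  | hl i =>
    have : Fin.cast (Nat.add_assoc a b c).symm (Fin.castAdd (b + c) i) =
      Fin.castAdd c (Fin.castAdd b i) := rfl
    simp only [this, finTensor_left]; rfl
  | hr i =>
  induction i using fin_cases with
  | hl i =>
    have : Fin.cast (Nat.add_assoc a b c).symm (Fin.natAdd a (Fin.castAdd c i)) =
      Fin.castAdd c (Fin.natAdd a i) := rfl
    simp only [this, finTensor_left, finTensor_right]; rfl
  | hr i =>
    have : Fin.cast (Nat.add_assoc a b c).symm (Fin.natAdd a (Fin.natAdd b i)) =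
      Fin.natAdd (a + b) i := Fin.ext (by simp [Nat.add_assoc])
    simp only [this, finTensor_right]
    exact Fin.ext (by simp [Nat.add_assoc])

theorem finTensor_zero_left {a b : ℕ} (f : Fin a → Fin b) (x : Fin a) :
    Fin.cast (Nat.zero_add b) (finTensor (fun i : Fin 0 => i) f
      (Fin.cast (Nat.zero_add a).symm x)) = f x := by
  have : Fin.cast (Nat.zero_add a).symm x = Fin.natAdd 0 x := Fin.ext (by simp)
  rw [this, finTensor_right]
  exact Fin.ext (by simp)

theorem finTensor_zero_right {a b : ℕ} (f : Fin a → Fin b) (x : Fin a) :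
    Fin.cast (Nat.add_zero b) (finTensor f (fun i : Fin 0 => i)
      (Fin.cast (Nat.add_zero a).symm x)) = f x := by
  have : Fin.cast (Nat.add_zero a).symm x = Fin.castAdd 0 x := Fin.ext (by simp)
  rw [this, finTensor_left]
  exact Fin.ext (by simp)

theorem finSymm_natural {a b c d : ℕ} (f : Fin a → Fin b) (g : Fin c → Fin d) (x : Fin (a + c)) :
    finSymm b d (finTensor f g x) = finTensor g f (finSymm a c x) := by
  induction x using fin_cases <;> simp

theorem finSymm_symm {a b : ℕ} (x : Fin (a + b)) : finSymm b a (finSymm a b x) = x := by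
  induction x using fin_cases <;> simp

theorem finSymm_hexagon {a b c : ℕ} (x : Fin (a + b + c)) :
    Fin.cast (Nat.add_assoc b c a) (finSymm a (b + c) (Fin.cast (Nat.add_assoc a b c) x)) =
      finTensor (fun i : Fin b => i) (finSymm a c) (Fin.cast (Nat.add_assoc b a c)
        (finTensor (finSymm a b) (fun i : Fin c => i) x)) := by
  induction x using fin_cases with
  | hr i =>
    have h1 : Fin.cast (Nat.add_assoc a b c) (Fin.natAdd (a + b) i) =
      Fin.natAdd a (Fin.natAdd b i) := Fin.ext (by simp [Nat.add_assoc])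
    have h2 : Fin.cast (Nat.add_assoc b a c) (Fin.natAdd (b + a) i) =
      Fin.natAdd b (Fin.natAdd a i) := Fin.ext (by simp [Nat.add_assoc])
    simp only [h1, h2, finTensor_right, finSymm_right]
    rfl
  | hl i =>
  induction i using fin_cases with
  | hl i =>
    have h1 : Fin.cast (Nat.add_assoc a b c) (Fin.castAdd c (Fin.castAdd b i)) =
      Fin.castAdd (b + c) i := rfl
    have h2 : Fin.cast (Nat.add_assoc b a c) (Fin.castAdd c (Fin.natAdd b i)) =
      Fin.natAdd b (Fin.castAdd c i) := rfl
    simp only [h1, h2, finTensor_left, finTensor_right, finSymm_left]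
    exact Fin.ext (by simp [Nat.add_assoc])
  | hr i =>
    have h1 : Fin.cast (Nat.add_assoc a b c) (Fin.castAdd c (Fin.natAdd a i)) =
      Fin.natAdd a (Fin.castAdd c i) := rfl
    have h2 : Fin.cast (Nat.add_assoc b a c) (Fin.castAdd c (Fin.castAdd a i)) =
      Fin.castAdd (a + c) i := rfl
    simp only [h1, h2, finTensor_left, finSymm_right]
    rfl

/-- The operations of the prop of functions between finite ordinals. -/
def fData : PROPData.{0} where
  Hom n m := Fin n → Fin m
  id _ := fun i => i
  comp f g := fun i => g (f i)
  tensor f g := finTensor f g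
  symm a b := finSymm a b

theorem fData_cast {a a' b b' : ℕ} (h : a = a') (h' : b = b') (f : fData.Hom a b) :
    fData.cast h h' f = fun i : Fin a' => Fin.cast h' (f (Fin.cast h.symm i)) := by
  subst h h'; rfl

/-- The prop `F` whose arrows `n → m` are the functions from `Fin n` to `Fin m`. -/
def F : PROP.{0} where
  toPROPData := fData
  id_comp _ := rfl
  comp_id _ := rfl
  assoc _ _ _ := rfl
  tensor_id a b := funext finTensor_id
  tensor_comp f g f' g' := funext (finTensor_comp f g f' g')
  tensor_assoc f g h := (fData_cast _ _ _).trans (funext (finTensor_assoc f g h))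
  unit_tensor f := (fData_cast _ _ _).trans (funext (finTensor_zero_left f))
  tensor_unit f := (fData_cast _ _ _).trans (funext (finTensor_zero_right f))
  symm_natural f g := funext (finSymm_natural f g)
  symm_symm a b := funext finSymm_symm
  hexagon a b c := by
    have e := fData_cast rfl (Nat.add_assoc b a c) (fData.tensor (fData.symm a b) (fData.id c))
    exact (fData_cast _ _ _).trans (.trans (funext finSymm_hexagon) (congrArg (fun t =>
      fData.comp t (fData.tensor (fData.id b) (fData.symm a c))) e.symm))

theorem f_isPushout_mk {z x y p : ℕ} {f : Fin z → Fin x} {g : Fin z → Fin y} {h : Fin x → Fin p}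
    {i : Fin y → Fin p} (w : ∀ t, h (f t) = i (g t))
    (hd : ∀ (k : ℕ) (a : Fin x → Fin k) (b : Fin y → Fin k), (∀ t, a (f t) = b (g t)) →
      ∃ d : Fin p → Fin k, (∀ t, d (h t) = a t) ∧ ∀ t, d (i t) = b t)
    (hs : ∀ s, (∃ t, h t = s) ∨ ∃ t, i t = s) :
    IsPushout (F.ar f) (F.ar g) (F.ar h) (F.ar i) := by
  refine ⟨⟨funext w⟩, ⟨?_⟩⟩
  have key (s : PushoutCocone (F.ar f) (F.ar g)) := hd s.pt.n s.inl s.inr (congrFun s.condition)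
  choose d hl hr using key
  refine PushoutCocone.IsColimit.mk _ d (fun s => funext (hl s)) (fun s => funext (hr s)) ?_
  intro s m hm hm'
  funext q
  obtain ⟨t, rfl⟩ | ⟨t, rfl⟩ := hs q
  · exact (congrFun hm t).trans (hl s t).symm
  · exact (congrFun hm' t).trans (hr s t).symm

/-- The universal property of pushouts in `F`, with values in an arbitrary finite type. -/
theorem f_isPushout_desc {z x y p : ℕ} {f : Fin z → Fin x} {g : Fin z → Fin y} {h : Fin x → Fin p}
    {i : Fin y → Fin p} (sq : IsPushout (F.ar f) (F.ar g) (F.ar h) (F.ar i))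
    {T : Type} [Finite T] (a : Fin x → T) (b : Fin y → T) (hab : ∀ t, a (f t) = b (g t)) :
    ∃ d : Fin p → T, (∀ t, d (h t) = a t) ∧ ∀ t, d (i t) = b t := by
  let e := Finite.equivFin T
  have w : F.ar f ≫ F.ar (fun t => e (a t)) = F.ar g ≫ F.ar (fun t => e (b t)) :=
    funext fun t => congrArg e (hab t)
  refine ⟨fun s => e.symm ((sq.desc _ _ w : Fin p → Fin _) s), fun t => ?_, fun t => ?_⟩
  · exact e.symm_apply_eq.2 (congrFun (sq.inl_desc _ _ w) t)
  · exact e.symm_apply_eq.2 (congrFun (sq.inr_desc _ _ w) t)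

theorem f_isPushout_surj {z x y p : ℕ} {f : Fin z → Fin x} {g : Fin z → Fin y} {h : Fin x → Fin p}
    {i : Fin y → Fin p} (sq : IsPushout (F.ar f) (F.ar g) (F.ar h) (F.ar i)) (s : Fin p) :
    (∃ t, h t = s) ∨ ∃ t, i t = s := by
  classical
  by_contra hs
  push Not at hs
  have : F.ar (fun _ : Fin p => (0 : Fin 2)) = F.ar (fun q : Fin p => if q = s then 1 else 0) := by
    refine sq.hom_ext (funext fun t => ?_) (funext fun t => ?_)
    · exact (if_neg (hs.1 t)).symm
    · exact (if_neg (hs.2 t)).symm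
  have := congrFun this s
  simp at this

theorem f_exists_isPushout {z x y : ℕ} (f : Fin z → Fin x) (g : Fin z → Fin y) :
    ∃ (p : ℕ) (h : Fin x → Fin p) (i : Fin y → Fin p),
      IsPushout (F.ar f) (F.ar g) (F.ar h) (F.ar i) := by
  let r : Fin x ⊕ Fin y → Fin x ⊕ Fin y → Prop :=
    fun a b => ∃ t, a = Sum.inl (f t) ∧ b = Sum.inr (g t)
  let e := Finite.equivFin (Quot r)
  refine ⟨_, fun t => e (Quot.mk r (Sum.inl t)), fun t => e (Quot.mk r (Sum.inr t)),
    f_isPushout_mk (fun t => congrArg e (Quot.sound ⟨t, rfl, rfl⟩)) ?_ ?_⟩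
  · intro k a b hab
    refine ⟨fun s => Quot.lift (Sum.elim a b) ?_ (e.symm s), fun t => ?_, fun t => ?_⟩
    · rintro _ _ ⟨t, rfl, rfl⟩; exact hab t
    · simp
    · simp
  · intro s
    obtain ⟨s, rfl⟩ := e.surjective s
    obtain ⟨s | s⟩ := s
    · exact .inl ⟨s, rfl⟩
    · exact .inr ⟨s, rfl⟩

theorem f_isPushout_tensor {z x y p z' x' y' p' : ℕ} {f : Fin z → Fin x} {g : Fin z → Fin y}
    {h : Fin x → Fin p} {i : Fin y → Fin p} {f' : Fin z' → Fin x'} {g' : Fin z' → Fin y'}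
    {h' : Fin x' → Fin p'} {i' : Fin y' → Fin p'}
    (P : IsPushout (F.ar f) (F.ar g) (F.ar h) (F.ar i))
    (P' : IsPushout (F.ar f') (F.ar g') (F.ar h') (F.ar i')) :
    IsPushout (F.ar (finTensor f f')) (F.ar (finTensor g g')) (F.ar (finTensor h h'))
      (F.ar (finTensor i i')) := by
  refine f_isPushout_mk (fun t => ?_) ?_ ?_
  · have w : ∀ t, h (f t) = i (g t) := congrFun P.w
    have w' : ∀ t, h' (f' t) = i' (g' t) := congrFun P'.w
    induction t using fin_cases <;> simp [w, w']
  · intro k a b hab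
    obtain ⟨d, h1, h2⟩ := f_isPushout_desc P (fun t => a (Fin.castAdd _ t))
      (fun t => b (Fin.castAdd _ t)) (fun t => by simpa using hab (Fin.castAdd _ t))
    obtain ⟨d', h1', h2'⟩ := f_isPushout_desc P' (fun t => a (Fin.natAdd _ t))
      (fun t => b (Fin.natAdd _ t)) (fun t => by simpa using hab (Fin.natAdd _ t))
    refine ⟨Fin.addCases d d', fun t => ?_, fun t => ?_⟩
    · induction t using fin_cases <;> simp [h1, h1']
    · induction t using fin_cases <;> simp [h2, h2']
  · intro s
    induction s using fin_cases with
    | hl s =>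
      obtain ⟨t, ht⟩ | ⟨t, ht⟩ := f_isPushout_surj P s
      · exact .inl ⟨Fin.castAdd _ t, by simp [ht]⟩
      · exact .inr ⟨Fin.castAdd _ t, by simp [ht]⟩
    | hr s =>
      obtain ⟨t, ht⟩ | ⟨t, ht⟩ := f_isPushout_surj P' s
      · exact .inl ⟨Fin.natAdd _ t, by simp [ht]⟩
      · exact .inr ⟨Fin.natAdd _ t, by simp [ht]⟩

instance : MonoidalPushouts F where
  hasPushouts := by
    have (X Y Z : F.Obj) (f : X ⟶ Y) (g : X ⟶ Z) : HasColimit (Limits.span f g) := by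
      obtain ⟨p, h, i, sq⟩ := f_exists_isPushout f g
      exact sq.hasPushout
    exact hasPushouts_of_hasColimit_span _
  isPushout_tensor P P' := f_isPushout_tensor P P'

/-- The class of surjective functions. -/
def surj : MorphismProperty F.Obj := fun X Y f => Function.Surjective (f : Fin X.n → Fin Y.n)

/-- The class of injective functions. -/
def inj : MorphismProperty F.Obj := fun X Y f => Function.Injective (f : Fin X.n → Fin Y.n)

theorem finTensor_injective {a b c d : ℕ} {f : Fin a → Fin b} {g : Fin c → Fin d}
    (hf : Function.Injective f) (hg : Function.Injective g) :
    Function.Injective (finTensor f g) := by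
  intro x y h
  induction x using fin_cases with
  | hl x =>
    induction y using fin_cases with
    | hl y => simp at h; rw [hf h]
    | hr y => have := congrArg Fin.val h; simp at this; omega
  | hr x =>
    induction y using fin_cases with
    | hl y => have := congrArg Fin.val h; simp at this; omega
    | hr y => simp at h; rw [hg h]

theorem surj_comp {a b c : ℕ} {f : Fin a → Fin b} {g : Fin b → Fin c}
    (hf : Function.Surjective f) (hg : Function.Surjective g) :
    Function.Surjective fun i => g (f i) := hg.comp hf

theorem inj_comp {a b c : ℕ} {f : Fin a → Fin b} {g : Fin b → Fin c}
    (hf : Function.Injective f) (hg : Function.Injective g) :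
    Function.Injective fun i => g (f i) := hg.comp hf

theorem exists_surj_inj {a b : ℕ} (f : Fin a → Fin b) :
    ∃ (c : ℕ) (e : Fin a → Fin c) (m : Fin c → Fin b), Function.Surjective e ∧
      Function.Injective m ∧ ∀ t, m (e t) = f t := by
  let d := Finite.equivFin (Set.range f)
  exact ⟨_, fun t => d ⟨f t, t, rfl⟩, fun s => (d.symm s).1,
    d.surjective.comp (fun ⟨_, t, h⟩ => ⟨t, Subtype.ext h⟩),
    Subtype.val_injective.comp d.symm.injective, fun _ =>
      congrArg Subtype.val (d.symm_apply_apply _)⟩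

theorem existsUnique_surj_inj_diag {x y z x' y' z' : ℕ} (e : Fin x → Fin z) (m : Fin z → Fin y)
    (e' : Fin x' → Fin z') (m' : Fin z' → Fin y') (he : Function.Surjective e)
    (hm' : Function.Injective m') (u : Fin x → Fin x') (v : Fin y → Fin y')
    (w : ∀ t, v (m (e t)) = m' (e' (u t))) :
    ∃! s : Fin z → Fin z', (fun t => s (e t)) = (fun t => e' (u t)) ∧
      (fun t => m' (s t)) = fun t => v (m t) := by
  choose k hk using he
  have h1 : ∀ t, e' (u (k (e t))) = e' (u t) := fun t => hm' (by rw [← w, ← w, hk])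
  refine ⟨fun s => e' (u (k s)), ⟨funext h1, funext fun s => ?_⟩, ?_⟩
  · change m' (e' (u (k s))) = v (m s)
    rw [← w, hk]
  · rintro s ⟨hs, -⟩
    funext t
    rw [← hk t]
    exact (congrFun hs (k t)).trans (h1 _).symm

/-- The (surjection, injection) factorisation system on `F`. -/
def surjInj : CostableSystem F where
  E := surj
  M := inj
  E_mul :=
    { id_mem := fun _ => Function.surjective_id
      comp_mem := fun f g (hf : Function.Surjective f) (hg : Function.Surjective g) =>
        surj_comp (f := f) (g := g) hf hg }
  M_mul :=
    { id_mem := fun _ => Function.injective_id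
      comp_mem := fun f g (hf : Function.Injective f) (hg : Function.Injective g) =>
        inj_comp (f := f) (g := g) hf hg }
  E_iso f _ := fun y => ⟨(inv f : _ → Fin _) y, congrFun (IsIso.inv_hom_id f) y⟩
  M_iso f _ := Function.LeftInverse.injective (g := (inv f : _ → Fin _))
    (congrFun (IsIso.hom_inv_id f))
  exists_fac f := by
    obtain ⟨c, e, m, he, hm, h⟩ := exists_surj_inj f
    exact ⟨F.ob c, e, m, he, hm, funext h⟩
  existsUnique_diag e m e' m' he _ _ hm' u v w :=
    existsUnique_surj_inj_diag e m e' m' he hm' u v (congrFun w)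
  costable :=
    { of_isPushout := by
        intro A A' B B' f g f' g' sq hf y y' hy
        classical
        let f₁ : Fin A.n → Fin A'.n := f
        let g₁ : Fin A.n → Fin B.n := g
        have hf : Function.Injective f₁ := hf
        obtain ⟨d, -, hd⟩ := f_isPushout_desc sq.flip (T := Option (Fin B.n))
          (fun a => if h : ∃ t, f₁ t = a then some (g₁ h.choose) else none) some (by
            intro t
            have h : ∃ s, f₁ s = f₁ t := ⟨t, rfl⟩
            change (if h : ∃ s, f₁ s = f₁ t then some (g₁ h.choose) else none) = some (g₁ t)
            rw [dif_pos h, hf h.choose_spec])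
        exact Option.some_injective _ ((hd y).symm.trans ((congrArg d hy).trans (hd y'))) }
  M_tensor f g hf hg := finTensor_injective hf hg

/-- The injective functions from `Fin n` to `Fin m`. -/
abbrev InjFun (n m : ℕ) : Type := {f : Fin n → Fin m // Function.Injective f}

/-- The prop `Inj` of injective functions, a sub-prop of `F`. -/
def Inj : PROP.{0} :=
  ofInjective F
    { Hom n m := InjFun n m
      id _ := ⟨fun i => i, Function.injective_id⟩
      comp f g := ⟨fun i => g.1 (f.1 i), inj_comp f.2 g.2⟩
      tensor f g := ⟨finTensor f.1 g.1, finTensor_injective f.2 g.2⟩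
      symm a b := ⟨finSymm a b, Function.LeftInverse.injective finSymm_symm⟩ }
    Subtype.val (fun _ _ => Subtype.ext) (fun _ => rfl) (fun _ _ => rfl) (fun _ _ => rfl)
    (fun _ _ => rfl)

/-- The inclusion of `Inj` in `F`. -/
def injIncl : Inj ⟶ F where
  map := Subtype.val
  map_id _ := rfl
  map_comp _ _ := rfl
  map_tensor _ _ := rfl
  map_symm _ _ := rfl

theorem inj_isPullback_mk {z x y p : ℕ} {f : InjFun x z} {g : InjFun y z} {h : InjFun p x}
    {i : InjFun p y} (w : ∀ t, f.1 (h.1 t) = g.1 (i.1 t))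
    (hd : ∀ a b, f.1 a = g.1 b → ∃ t, h.1 t = a ∧ i.1 t = b) :
    IsPushout (Inj.op.ar f) (Inj.op.ar g) (Inj.op.ar h) (Inj.op.ar i) := by
  refine ⟨⟨Subtype.ext (p := Function.Injective) (funext w)⟩, ⟨?_⟩⟩
  have key (s : PushoutCocone (Inj.op.ar f) (Inj.op.ar g)) (t : Fin s.pt.n) :
      ∃ q, h.1 q = (s.inl : InjFun s.pt.n x).1 t ∧ i.1 q = (s.inr : InjFun s.pt.n y).1 t :=
    hd _ _ (congrFun (congrArg (Subtype.val (p := Function.Injective)) s.condition) t)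
  choose d hl hr using key
  have hinj (s) : Function.Injective (d s) := fun t t' htt =>
    (s.inl : InjFun s.pt.n x).2 ((hl s t).symm.trans ((congrArg h.1 htt).trans (hl s t')))
  refine PushoutCocone.IsColimit.mk _ (fun s => (⟨d s, hinj s⟩ : InjFun s.pt.n p))
    (fun s => Subtype.ext (p := Function.Injective) (funext (hl s)))
    (fun s => Subtype.ext (p := Function.Injective) (funext (hr s))) ?_
  intro s m hm hm'
  refine Subtype.ext (p := Function.Injective) (funext fun t => h.2 ?_)
  exact (congrFun (congrArg (Subtype.val (p := Function.Injective)) hm) t).trans (hl s t).symm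

theorem inj_isPullback_ex {z x y p : ℕ} {f : InjFun x z} {g : InjFun y z} {h : InjFun p x}
    {i : InjFun p y} (sq : IsPushout (Inj.op.ar f) (Inj.op.ar g) (Inj.op.ar h) (Inj.op.ar i))
    (a : Fin x) (b : Fin y) (hab : f.1 a = g.1 b) : ∃ t, h.1 t = a ∧ i.1 t = b := by
  let a' : InjFun 1 x := ⟨fun _ => a, fun _ _ _ => Subsingleton.elim _ _⟩
  let b' : InjFun 1 y := ⟨fun _ => b, fun _ _ _ => Subsingleton.elim _ _⟩
  have w : Inj.op.ar f ≫ Inj.op.ar (n := x) (m := 1) a' =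
      Inj.op.ar g ≫ Inj.op.ar (n := y) (m := 1) b' :=
    Subtype.ext (p := Function.Injective) (funext fun _ => hab)
  refine ⟨(sq.desc _ _ w : InjFun 1 p).1 0, ?_, ?_⟩
  · exact congrFun (congrArg (Subtype.val (p := Function.Injective)) (sq.inl_desc _ _ w)) 0
  · exact congrFun (congrArg (Subtype.val (p := Function.Injective)) (sq.inr_desc _ _ w)) 0

theorem inj_exists_isPullback {x y z : ℕ} (f : InjFun x z) (g : InjFun y z) :
    ∃ (p : ℕ) (h : InjFun p x) (i : InjFun p y),
      IsPushout (Inj.op.ar f) (Inj.op.ar g) (Inj.op.ar h) (Inj.op.ar i) := by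
  let T := {q : Fin x × Fin y // f.1 q.1 = g.1 q.2}
  let e := Finite.equivFin T
  have h1 : Function.Injective fun t : T => t.1.1 := fun t t' ht =>
    Subtype.ext (Prod.ext ht (g.2 (t.2.symm.trans ((congrArg f.1 ht).trans t'.2))))
  have h2 : Function.Injective fun t : T => t.1.2 := fun t t' ht =>
    Subtype.ext (Prod.ext (f.2 (t.2.trans ((congrArg g.1 ht).trans t'.2.symm))) ht)
  exact ⟨Nat.card T, ⟨fun t => (e.symm t).1.1, h1.comp e.symm.injective⟩,
    ⟨fun t => (e.symm t).1.2, h2.comp e.symm.injective⟩,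
    inj_isPullback_mk (fun t => (e.symm t).2) (fun a b hab => ⟨e ⟨(a, b), hab⟩, by simp, by simp⟩)⟩

theorem inj_isPullback_tensor {z x y p z' x' y' p' : ℕ} {f : InjFun x z} {g : InjFun y z}
    {h : InjFun p x} {i : InjFun p y} {f' : InjFun x' z'} {g' : InjFun y' z'} {h' : InjFun p' x'}
    {i' : InjFun p' y'} (P : IsPushout (Inj.op.ar f) (Inj.op.ar g) (Inj.op.ar h) (Inj.op.ar i))
    (P' : IsPushout (Inj.op.ar f') (Inj.op.ar g') (Inj.op.ar h') (Inj.op.ar i')) :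
    IsPushout (Inj.op.ar (Inj.tensor f f')) (Inj.op.ar (Inj.tensor g g'))
      (Inj.op.ar (Inj.tensor h h')) (Inj.op.ar (Inj.tensor i i')) := by
  refine inj_isPullback_mk (f := Inj.tensor f f') (g := Inj.tensor g g')
    (h := Inj.tensor h h') (i := Inj.tensor i i') ?_ ?_
  · intro t
    change finTensor f.1 f'.1 (finTensor h.1 h'.1 t) = finTensor g.1 g'.1 (finTensor i.1 i'.1 t)
    have w : ∀ t, f.1 (h.1 t) = g.1 (i.1 t) :=
      congrFun (congrArg (Subtype.val (p := Function.Injective)) P.w)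
    have w' : ∀ t, f'.1 (h'.1 t) = g'.1 (i'.1 t) :=
      congrFun (congrArg (Subtype.val (p := Function.Injective)) P'.w)
    induction t using fin_cases <;> simp [w, w']
  · intro a b
    change finTensor f.1 f'.1 a = finTensor g.1 g'.1 b →
      ∃ t, finTensor h.1 h'.1 t = a ∧ finTensor i.1 i'.1 t = b
    intro hab
    induction a using fin_cases with
    | hl a =>
      induction b using fin_cases with
      | hl b =>
        obtain ⟨t, rfl, rfl⟩ := inj_isPullback_ex P a b (by simpa using hab)
        exact ⟨Fin.castAdd _ t, by simp, by simp⟩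
      | hr b => have := congrArg Fin.val hab; simp at this; omega
    | hr a =>
      induction b using fin_cases with
      | hl b => have := congrArg Fin.val hab; simp at this; omega
      | hr b =>
        obtain ⟨t, rfl, rfl⟩ := inj_isPullback_ex P' a b (by simpa using hab)
        exact ⟨Fin.natAdd _ t, by simp, by simp⟩

instance : MonoidalPushouts Inj.op where
  hasPushouts := by
    have (X Y Z : Inj.op.Obj) (f : X ⟶ Y) (g : X ⟶ Z) : HasColimit (Limits.span f g) := by
      obtain ⟨p, h, i, sq⟩ := inj_exists_isPullback f g
      exact sq.hasPushout
    exact hasPushouts_of_hasColimit_span _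
  isPushout_tensor P P' := inj_isPullback_tensor P P'

/-! The prop of equivalence relations. -/

/-- The gluing of two equivalence relations on `α ⊕ β` and `β ⊕ γ`: the equivalence relation on
`α ⊕ β ⊕ γ` generated by both. -/
def glue {α β γ : Type*} (e₁ : Setoid (α ⊕ β)) (e₂ : Setoid (β ⊕ γ)) : Setoid (α ⊕ β ⊕ γ) :=
  Relation.EqvGen.setoid fun x y =>
    (∃ a b, e₁ a b ∧ x = Sum.map id Sum.inl a ∧ y = Sum.map id Sum.inl b) ∨
      ∃ a b, e₂ a b ∧ x = Sum.inr a ∧ y = Sum.inr b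

/-- The disjoint union of two equivalence relations. -/
def sumSetoid {α β : Type*} (e₁ : Setoid α) (e₂ : Setoid β) : Setoid (α ⊕ β) where
  r := Sum.LiftRel e₁ e₂
  iseqv :=
    { refl := by rintro (x | x) <;> simp
      symm := by
        rintro _ _ (h | h)
        · exact .inl (e₁.symm h)
        · exact .inr (e₂.symm h)
      trans := by
        rintro _ _ _ (h | h) (h' | h')
        · exact .inl (e₁.trans h h')
        · exact .inr (e₂.trans h h') }

/-- The bijection that splits `(a + c) ⊎ (b + d)` as `(a ⊎ b) ⊎ (c ⊎ d)`. -/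
def splitSum (a b c d : ℕ) : Fin (a + c) ⊕ Fin (b + d) → (Fin a ⊕ Fin b) ⊕ (Fin c ⊕ Fin d) :=
  Sum.elim (Fin.addCases (fun i => .inl (.inl i)) (fun i => .inr (.inl i)))
    (Fin.addCases (fun i => .inl (.inr i)) (fun i => .inr (.inr i)))

/-- The operations on equivalence relations: an arrow `n → m` is an equivalence relation on
`Fin n ⊕ Fin m`; the composite of two of them is the restriction of their gluing; the tensor is
disjoint union; the identity and the symmetry identify the elements that correspond to each other
under the identity function and under the exchange of blocks. -/
def erData : PROPData.{0} where
  Hom n m := Setoid (Fin n ⊕ Fin m)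
  id _ := Setoid.ker (Sum.elim id id)
  comp e₁ e₂ := (glue e₁ e₂).comap (Sum.map id Sum.inr)
  tensor {a b c d} e₁ e₂ := (sumSetoid e₁ e₂).comap (splitSum a b c d)
  symm a b := Setoid.ker (Sum.elim (finSymm a b) id)

/-- The equivalence relation of a cospan: the kernel of the copairing of its legs. -/
def cospanKer {n m k : ℕ} (f : Fin n → Fin k) (g : Fin m → Fin k) : Setoid (Fin n ⊕ Fin m) :=
  Setoid.ker (Sum.elim f g)

theorem cospanKer_comp {n m k x y p : ℕ} (f : Fin n → Fin x) (g : Fin m → Fin x)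
    (h : Fin m → Fin y) (l : Fin k → Fin y) (i : Fin x → Fin p) (j : Fin y → Fin p)
    (sq : IsPushout (F.ar g) (F.ar h) (F.ar i) (F.ar j)) :
    cospanKer (fun t => i (f t)) (fun t => j (l t)) =
      (glue (cospanKer f g) (cospanKer h l)).comap (Sum.map id Sum.inr) := by
  classical
  have w : ∀ t, i (g t) = j (h t) := congrFun sq.w
  have hker {α β : Type} (u : α → β) (a b : α) : Setoid.ker u a b ↔ u a = u b := Iff.rfl
  let G := glue (cospanKer f g) (cospanKer h l)
  let Q := Quotient G
  have e₁ : ∀ a b, Sum.elim f g a = Sum.elim f g b →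
      (Quotient.mk G (Sum.map id Sum.inl a) : Q) = Quotient.mk G (Sum.map id Sum.inl b) :=
    fun a b hab => Quotient.sound (.rel _ _ (.inl ⟨a, b, hab, rfl, rfl⟩))
  have e₂ : ∀ a b, Sum.elim h l a = Sum.elim h l b →
      (Quotient.mk G (Sum.inr a) : Q) = Quotient.mk G (Sum.inr b) :=
    fun a b hab => Quotient.sound (.rel _ _ (.inr ⟨a, b, hab, rfl, rfl⟩))
  let u : Fin x → Option Q := fun s =>
    if hs : ∃ a, Sum.elim f g a = s then some (Quotient.mk G (Sum.map id Sum.inl hs.choose)) else none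
  let v : Fin y → Option Q := fun s =>
    if hs : ∃ a, Sum.elim h l a = s then some (Quotient.mk G (Sum.inr hs.choose)) else none
  have hu : ∀ a, u (Sum.elim f g a) = some (Quotient.mk G (Sum.map id Sum.inl a)) := fun a => by
    have hs : ∃ b, Sum.elim f g b = Sum.elim f g a := ⟨a, rfl⟩
    exact (dif_pos hs).trans (congrArg some (e₁ _ _ hs.choose_spec))
  have hv : ∀ a, v (Sum.elim h l a) = some (Quotient.mk G (Sum.inr a)) := fun a => by
    have hs : ∃ b, Sum.elim h l b = Sum.elim h l a := ⟨a, rfl⟩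
    exact (dif_pos hs).trans (congrArg some (e₂ _ _ hs.choose_spec))
  obtain ⟨d, hd, hd'⟩ := f_isPushout_desc sq u v
    (fun t => (hu (.inr t)).trans (hv (.inl t)).symm)
  let c : Fin n ⊕ Fin k → Fin p := Sum.elim (fun t => i (f t)) (fun t => j (l t))
  have hc : ∀ a, d (c a) = some (Quotient.mk G (Sum.map id Sum.inr a)) := by
    rintro (a | a)
    · exact (hd _).trans (hu (.inl a))
    · exact (hd' _).trans (hv (.inr a))
  ext a b
  constructor
  · intro hab
    exact Quotient.exact (s := G)
      (Option.some_injective _ ((hc a).symm.trans ((congrArg d hab).trans (hc b))))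
  · intro hab
    let c' : Fin n ⊕ Fin m ⊕ Fin k → Fin p :=
      Sum.elim (fun t => i (f t)) (Sum.elim (fun t => i (g t)) (fun t => j (l t)))
    have hG : G ≤ Setoid.ker c' := by
      refine Setoid.eqvGen_le ?_
      rintro _ _ (⟨a, b, hab, rfl, rfl⟩ | ⟨a, b, hab, rfl, rfl⟩)
      · have hc' : ∀ a, c' (Sum.map id Sum.inl a) = i (Sum.elim f g a) := by rintro (a | a) <;> rfl
        exact (hc' a).trans ((congrArg i hab).trans (hc' b).symm)
      · have hc' : ∀ a, c' (Sum.inr a) = j (Sum.elim h l a) := by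
          rintro (a | a)
          · exact w a
          · rfl
        exact (hc' a).trans ((congrArg j hab).trans (hc' b).symm)
    have := hG hab
    rcases a with a | a <;> rcases b with b | b <;> exact this

theorem cospanKer_tensor {a b c d x y : ℕ} (f : Fin a → Fin x) (g : Fin b → Fin x)
    (h : Fin c → Fin y) (l : Fin d → Fin y) :
    cospanKer (finTensor f h) (finTensor g l) =
      (sumSetoid (cospanKer f g) (cospanKer h l)).comap (splitSum a b c d) := by
  have hs : ∀ s, Sum.elim (finTensor f h) (finTensor g l) s =
      Sum.elim (fun t => Fin.castAdd y (Sum.elim f g t)) (fun t => Fin.natAdd x (Sum.elim h l t))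
        (splitSum a b c d s) := by
    rintro (s | s) <;> induction s using fin_cases <;> simp [splitSum]
  ext s t
  change Sum.elim (finTensor f h) (finTensor g l) s = Sum.elim (finTensor f h) (finTensor g l) t ↔
    Sum.LiftRel _ _ (splitSum a b c d s) (splitSum a b c d t)
  rw [hs, hs]
  generalize splitSum a b c d s = s
  generalize splitSum a b c d t = t
  rcases s with s | s <;> rcases t with t | t
  · rw [Sum.liftRel_inl_inl]; simp only [Sum.elim_inl, Fin.castAdd_inj]; rfl
  · simp only [Sum.elim_inl, Sum.elim_inr, Sum.not_liftRel_inl_inr, iff_false]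
    intro hst; have := congrArg Fin.val hst; simp at this; omega
  · simp only [Sum.elim_inl, Sum.elim_inr, Sum.not_liftRel_inr_inl, iff_false]
    intro hst; have := congrArg Fin.val hst; simp at this; omega
  · rw [Sum.liftRel_inr_inr]; simp only [Sum.elim_inr, Fin.natAdd_inj]; rfl

theorem cospanKer_surjective {n m : ℕ} (e : Setoid (Fin n ⊕ Fin m)) :
    ∃ (k : ℕ) (f : Fin n → Fin k) (g : Fin m → Fin k), cospanKer f g = e := by
  let d := Finite.equivFin (Quotient e)
  refine ⟨_, fun t => d (Quotient.mk e (.inl t)), fun t => d (Quotient.mk e (.inr t)), ?_⟩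
  have : ∀ a, Sum.elim (fun t => d (Quotient.mk e (.inl t))) (fun t => d (Quotient.mk e (.inr t))) a
      = d (Quotient.mk e a) := by rintro (a | a) <;> rfl
  ext a b
  change Sum.elim _ _ a = Sum.elim _ _ b ↔ _
  rw [this, this, d.apply_eq_iff_eq]
  exact Quotient.eq

/-- The kernel of an isomorphism class of cospans. -/
def cospanHomKer {n m : ℕ} : CospanHom F n m → Setoid (Fin n ⊕ Fin m) :=
  Quotient.lift (fun x => cospanKer x.left x.right) <| by
    rintro ⟨k, f, g⟩ ⟨k', f', g'⟩ ⟨e, h, h'⟩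
    let f₁ : Fin n → Fin k := f
    let g₁ : Fin m → Fin k := g
    let f₁' : Fin n → Fin k' := f'
    let g₁' : Fin m → Fin k' := g'
    let e₁ : Fin k → Fin k' := e.hom
    have he : Function.Injective e₁ :=
      Function.LeftInverse.injective (g := (e.inv : Fin k' → Fin k)) (congrFun e.hom_inv_id)
    have : ∀ a, Sum.elim f₁' g₁' a = e₁ (Sum.elim f₁ g₁ a) := by
      rintro (a | a)
      · exact (congrFun h a).symm
      · exact (congrFun h' a).symm
    ext a b
    change Sum.elim f₁ g₁ a = Sum.elim f₁ g₁ b ↔ Sum.elim f₁' g₁' a = Sum.elim f₁' g₁' b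
    rw [this, this, he.eq_iff]

/-- The prop `ER` of equivalence relations. -/
noncomputable def ER : PROP.{0} :=
  ofSurjective F.cospan erData cospanHomKer
    (fun e => by
      obtain ⟨k, f, g, h⟩ := cospanKer_surjective e
      exact ⟨cospanMk (C := F) f g, h⟩)
    (fun _ => rfl)
    (fun x y => by
      induction x using cospanMk_ind with | h a f g =>
      induction y using cospanMk_ind with | h b h l =>
      obtain ⟨p, i, j, sq⟩ := exists_isPushout g h
      exact (congrArg cospanHomKer (cospanData_comp_mk f g h l i j sq)).trans
        (cospanKer_comp f g h l i j sq))
    (fun x y => by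
      induction x using cospanMk_ind with | h a f g =>
      induction y using cospanMk_ind with | h b h l =>
      exact cospanKer_tensor f g h l)
    (fun _ _ => rfl)

end PROP

namespace PROP

/-! Isomorphisms of props and morphisms out of cospans and corelations. -/

/-! The argument is a comparison of presentations. Every cospan `n → k ← m` is an arrow of `C`
followed by an opposite arrow (`cospan_fac`), and composition by pushout says that an opposite arrow
followed by an arrow can be exchanged along any pushout square (`cospan_op_comp_hom`). Hence a
morphism out of `Cospan(C)` amounts to a morphism out of `C` and one out of `C.op` that respect this
exchange (`cospanDesc`, `cospan_hom_ext`). Spans in `Inj` are cospans in `Inj.op`, so the same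
result covers them, with pullbacks of injections as the exchange squares.

`Corel(C)` adds a single family of equations to `Cospan(C)`: an arrow `i` of the right class
followed by its opposite is an identity (`corelDesc`). For `F` an injection does not change kernels,
so the kernel descends to corelations. It is bijective there: by image factorisation each corelation
has a jointly surjective representative, and such a representative is determined up to isomorphism
by its kernel (`corelToER_bijective`).

The morphism `Π` exists because two injections into `z` and the pushout of their pullback give the
same corelation: that pushout is the union of the two images, so it maps injectively to `z`
(`pushout_of_pullback_injective`).

For the pushout property, the equation "`i` followed by its opposite is the identity" already holds
in `Span(Inj)`, since the pullback of an injection along itself is trivial (`span_hom_comp_op`). If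
morphisms out of `Cospan(F)` and `Span(Inj)` agree on `Inj` and `Inj.op`, the first one therefore
satisfies the equation and factors through `Corel(F)`. The factorisation is unique because `Γ` is
surjective on arrows, and it is compatible with `Π` because injections and their opposites generate
`Span(Inj)` (`corel_existsUnique_desc`). The isomorphism with `ER` transports the result. -/

theorem Mor.hom_ext {P : PROP.{u}} {Q : PROP.{v}} {F G : Mor P Q}
    (h : ∀ {n m : ℕ} (f : P.Hom n m), F.map f = G.map f) : F = G :=
  Mor.ext (funext fun _ => funext fun _ => funext fun f => h f)

/-- A morphism of props that is bijective on arrows is an isomorphism. -/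
noncomputable def isoOfBijective {P Q : PROP.{u}} (K : P ⟶ Q)
    (hK : ∀ n m : ℕ, Function.Bijective (Mor.map K : P.Hom n m → Q.Hom n m)) : P ≅ Q where
  hom := K
  inv :=
    { map := fun {n m} g => (Equiv.ofBijective _ (hK n m)).symm g
      map_id := fun n => (Equiv.symm_apply_eq _).2 (Mor.map_id K n).symm
      map_comp := fun {n m k} f g => (Equiv.symm_apply_eq _).2 <| by
        refine Eq.trans ?_ (Mor.map_comp K _ _).symm
        exact (congrArg₂ Q.comp ((Equiv.ofBijective _ (hK n m)).apply_symm_apply f)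
          ((Equiv.ofBijective _ (hK m k)).apply_symm_apply g)).symm
      map_tensor := fun {a b c d} f g => (Equiv.symm_apply_eq _).2 <| by
        refine Eq.trans ?_ (Mor.map_tensor K _ _).symm
        exact (congrArg₂ Q.tensor ((Equiv.ofBijective _ (hK a b)).apply_symm_apply f)
          ((Equiv.ofBijective _ (hK c d)).apply_symm_apply g)).symm
      map_symm := fun a b => (Equiv.symm_apply_eq _).2 (Mor.map_symm K a b).symm }
  hom_inv_id := Mor.hom_ext fun {n m} f => (Equiv.ofBijective _ (hK n m)).symm_apply_apply f
  inv_hom_id := Mor.hom_ext fun {n m} f => (Equiv.ofBijective _ (hK n m)).apply_symm_apply f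

section

variable {C : PROP.{u}} [MonoidalPushouts C]

/-- The pushout along identities is trivial. This is the normal form by which `C` and `C.op`
generate the cospans. -/
theorem cospan_fac {n m k : ℕ} (f : C.Hom n k) (g : C.Hom m k) :
    C.cospan.comp (Mor.map C.cospanOfHom f) (Mor.map C.cospanOfOp g) = cospanMk f g :=
  (cospanData_comp_hom f (C.id k) g).trans (by rw [C.comp_id])

/-- The outer legs are identities, so only the pushout remains. Together with `cospan_fac` this is
the exchange relation between both kinds of generators; for `C = Inj.op` it is exchange along a
pullback of injections. -/
theorem cospan_op_comp_hom {z x y p : ℕ} (f : C.Hom z x) (g : C.Hom z y) (i : C.Hom x p)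
    (j : C.Hom y p) (sq : IsPushout (C.ar f) (C.ar g) (C.ar i) (C.ar j)) :
    C.cospan.comp (Mor.map C.cospanOfOp f) (Mor.map C.cospanOfHom g) = cospanMk i j :=
  (cospanData_comp_mk (C.id x) f g (C.id y) i j sq).trans (by rw [C.id_comp, C.id_comp])

/-- Morphisms out of a prop of cospans are determined by both inclusions. -/
theorem cospan_hom_ext {P : PROP.{v}} {F G : Mor C.cospan P}
    (hl : Mor.trans C.cospanOfHom F = Mor.trans C.cospanOfHom G)
    (hr : Mor.trans C.cospanOfOp F = Mor.trans C.cospanOfOp G) : F = G := by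
  refine Mor.hom_ext fun x => ?_
  induction x using cospanMk_ind with | h k f g =>
  rw [← cospan_fac, F.map_comp, G.map_comp]
  exact congrArg₂ P.comp (congrArg (fun K : Mor C P => K.map f) hl)
    (congrArg (fun K : Mor C.op P => K.map g) hr)

/-- The morphism out of a prop of cospans given by two morphisms that exchange along pushout
squares. -/
def cospanDesc {P : PROP.{v}} (G : Mor C P) (H : Mor C.op P)
    (exch : ∀ {z x y p : ℕ} (f : C.Hom z x) (g : C.Hom z y) (i : C.Hom x p) (j : C.Hom y p),
      IsPushout (C.ar f) (C.ar g) (C.ar i) (C.ar j) →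
        P.comp (H.map f) (G.map g) = P.comp (G.map i) (H.map j)) : Mor C.cospan P where
  map {n m} := Quotient.lift (fun x : CospanRep C n m => P.comp (G.map x.left) (H.map x.right)) <| by
    rintro ⟨k, f, g⟩ ⟨k', f', g'⟩ ⟨e, h, h'⟩
    let e' : C.Hom k k' := e.hom
    -- `H` is a morphism out of `C.op`, so it reverses composites of `C`.
    have hr : H.map (C.comp g e') = P.comp (H.map e') (H.map g) :=
      H.map_comp (n := k') (m := k) (k := m) e' g
    have h₁ : C.comp f e' = f' := h
    have h₂ : C.comp g e' = g' := h'
    -- The exchange condition covers isomorphisms of apices: for invertible `e` the square with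
    -- sides `id`, `id`, `e`, `e` is a pushout, so `G e` followed by `H e` is the identity and the
    -- value does not depend on the representative.
    have key := exch (C.id k) (C.id k) e' e' <| by
      change IsPushout (𝟙 (C.ob k)) (𝟙 (C.ob k)) e.hom e.hom
      exact IsPushout.of_horiz_isIso ⟨rfl⟩
    have key' : P.comp (G.map e') (H.map e') = P.id k := by
      rw [← key, G.map_id]
      exact (P.comp_id _).trans (H.map_id k)
    change P.comp (G.map f) (H.map g) = P.comp (G.map f') (H.map g')
    rw [← h₁, ← h₂, G.map_comp, hr, P.assoc, ← P.assoc (G.map e'), key', P.id_comp]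
  map_id n := by
    change P.comp (G.map (C.id n)) (H.map (C.op.id n)) = _
    rw [G.map_id, H.map_id, P.id_comp]
  map_comp {n m k} x y := by
    induction x using cospanMk_ind with | h a f g =>
    induction y using cospanMk_ind with | h b h l =>
    obtain ⟨p, i, j, sq⟩ := exists_isPushout g h
    refine (congrArg _ (cospanData_comp_mk f g h l i j sq)).trans ?_
    have hr : H.map (C.comp l j) = P.comp (H.map j) (H.map l) :=
      H.map_comp (n := p) (m := b) (k := k) j l
    change P.comp (G.map (C.comp f i)) (H.map (C.comp l j)) =
      P.comp (P.comp (G.map f) (H.map g)) (P.comp (G.map h) (H.map l))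
    -- After reassociation the middle of the right-hand side is `H g` followed by `G h`, which the
    -- exchange turns into `G i` followed by `H j`.
    rw [G.map_comp, hr, P.assoc, P.assoc, ← P.assoc (H.map g), exch g h i j sq, P.assoc]
  map_tensor {a b c d} x y := by
    induction x using cospanMk_ind with | h k f g =>
    induction y using cospanMk_ind with | h l f' g' =>
    have hr : H.map (C.tensor g g') = P.tensor (H.map g) (H.map g') :=
      H.map_tensor (a := k) (b := b) (c := l) (d := d) g g'
    change P.comp (G.map (C.tensor f f')) (H.map (C.tensor g g')) = P.tensor
      (P.comp (G.map f) (H.map g)) (P.comp (G.map f') (H.map g'))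
    rw [G.map_tensor, hr, P.tensor_comp]
  map_symm a b := by
    change P.comp (G.map (C.symm a b)) (H.map (C.op.id (b + a))) = _
    rw [G.map_symm, H.map_id, P.comp_id]

/-- A morphism out of `Cospan(C)` that sends `i` followed by its opposite to the identity, for
every `i` in the right class, factors through `Corel(C)`. -/
def corelDesc (S : CostableSystem C) {P : PROP.{v}} (G : Mor C.cospan P)
    (hG : ∀ {k l : ℕ} (i : C.Hom k l), S.M (C.ar i) →
      P.comp (G.map (Mor.map C.cospanOfHom i)) (G.map (Mor.map C.cospanOfOp i)) = P.id k) :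
    Mor (corel S) P where
  map := Quot.lift G.map <| by
    rintro _ _ ⟨k, l, f, g, i, hi, rfl, rfl⟩
    -- Once both cospans are factored, they differ only by `i` followed by its opposite in the
    -- middle, which `hG` cancels.
    have hl := Mor.map_comp C.cospanOfHom f i
    have hr : Mor.map C.cospanOfOp (C.comp g i) = _ := Mor.map_comp C.cospanOfOp i g
    rw [← cospan_fac, ← cospan_fac, hl, hr, G.map_comp, G.map_comp, G.map_comp, G.map_comp,
      P.assoc, ← P.assoc (G.map (Mor.map C.cospanOfHom i)), hG i hi, P.id_comp]
  map_id := G.map_id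
  map_comp := by rintro n m k ⟨x⟩ ⟨y⟩; exact G.map_comp x y
  map_tensor := by rintro a b c d ⟨x⟩ ⟨y⟩; exact G.map_tensor x y
  map_symm := G.map_symm

/-- The quotient morphism is surjective on arrows, hence can be cancelled. -/
theorem corel_hom_ext {S : CostableSystem C} {P : PROP.{v}} {F G : Mor (corel S) P}
    (h : Mor.trans (cospanToCorel S) F = Mor.trans (cospanToCorel S) G) : F = G := by
  refine Mor.hom_ext fun x => ?_
  obtain ⟨x, rfl⟩ := Quot.exists_rep x
  exact congrArg (fun K : Mor C.cospan P => K.map x) h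

theorem corelMk_comp {S : CostableSystem C} {n m k l : ℕ} (f : C.Hom n k) (g : C.Hom m k)
    (i : C.Hom k l) (hi : S.M (C.ar i)) :
    corelMk S (C.comp f i) (C.comp g i) = corelMk S f g :=
  (Quot.sound ⟨k, l, f, g, i, hi, rfl, rfl⟩).symm

end

/-! Corelations of functions are equivalence relations. -/

/-- The kernel of a cospan, as a morphism of props. -/
noncomputable def cospanToER : Mor F.cospan ER where
  map x := cospanHomKer x
  map_id _ := rfl
  map_comp x y := by
    induction x using cospanMk_ind with | h a f g =>
    induction y using cospanMk_ind with | h b h l =>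
    obtain ⟨p, i, j, sq⟩ := exists_isPushout g h
    exact (congrArg cospanHomKer (cospanData_comp_mk f g h l i j sq)).trans
      (cospanKer_comp f g h l i j sq)
  map_tensor x y := by
    induction x using cospanMk_ind with | h a f g =>
    induction y using cospanMk_ind with | h b h l =>
    exact cospanKer_tensor f g h l
  map_symm _ _ := rfl

/-- An injection on apices creates no new identifications; this is what makes the kernel an
invariant of corelations. -/
theorem cospanKer_comp_injective {n m k l : ℕ} (f : Fin n → Fin k) (g : Fin m → Fin k)
    {i : Fin k → Fin l} (hi : Function.Injective i) :
    cospanKer (fun t => i (f t)) (fun t => i (g t)) = cospanKer f g := by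
  ext a b
  rcases a with a | a <;> rcases b with b | b <;> exact hi.eq_iff

/-- The kernel of a corelation, as a morphism of props. -/
noncomputable def corelToER : corel surjInj ⟶ ER :=
  corelDesc surjInj cospanToER fun {k _} i hi => by
    rw [← Mor.map_comp, cospan_fac, ← ER.id_comp (ER.id k)]
    -- The kernel of the cospan with both legs `i` is that of the cospan of identities, which is the
    -- identity relation; the composite with an identity introduced on the right is then removed.
    exact (cospanKer_comp_injective id id hi).trans (ER.id_comp _).symm

/-- Every corelation of functions is represented by a jointly surjective cospan. -/
theorem corel_exists_surjective {n m : ℕ} (x : (corel surjInj).Hom n m) :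
    ∃ (k : ℕ) (f : Fin n → Fin k) (g : Fin m → Fin k),
      Function.Surjective (Sum.elim f g) ∧ x = corelMk surjInj f g := by
  obtain ⟨x, rfl⟩ := Quot.exists_rep x
  induction x using cospanMk_ind with | h k f g =>
  let f₁ : Fin n → Fin k := f
  let g₁ : Fin m → Fin k := g
  -- Image factorisation of the copairing, with the image numbered by `d`: `c` is the surjective
  -- part and `i` the injective part, which a corelation ignores.
  let d := Finite.equivFin (Set.range (Sum.elim f₁ g₁))
  let c : Fin n ⊕ Fin m → Fin (Nat.card (Set.range (Sum.elim f₁ g₁))) := fun t => d ⟨_, t, rfl⟩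
  let i : Fin (Nat.card (Set.range (Sum.elim f₁ g₁))) → Fin k := fun s => (d.symm s).1
  have hc : ∀ t, i (c t) = Sum.elim f₁ g₁ t := fun t =>
    congrArg Subtype.val (d.symm_apply_apply _)
  refine ⟨_, fun t => c (.inl t), fun t => c (.inr t), ?_, ?_⟩
  · have : Sum.elim (fun t => c (.inl t)) (fun t => c (.inr t)) = c := Sum.elim_comp_inl_inr c
    rw [this]
    exact d.surjective.comp fun ⟨_, t, h⟩ => ⟨t, Subtype.ext h⟩
  · refine Eq.trans ?_ (corelMk_comp (C := F) (S := surjInj) (fun t => c (.inl t))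
      (fun t => c (.inr t)) i (Subtype.val_injective.comp d.symm.injective))
    exact congrArg₂ (corelMk surjInj) (funext fun t => (hc (.inl t)).symm)
      (funext fun t => (hc (.inr t)).symm)

/-- Jointly surjective cospans of functions with the same kernel are isomorphic. -/
theorem cospanMk_eq_of_ker_eq {n m k l : ℕ} {f : Fin n → Fin k} {g : Fin m → Fin k}
    {f' : Fin n → Fin l} {g' : Fin m → Fin l} (h : Function.Surjective (Sum.elim f g))
    (h' : Function.Surjective (Sum.elim f' g')) (e : cospanKer f g = cospanKer f' g') :
    cospanMk (C := F) f g = cospanMk (C := F) f' g' := by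
  have he (a b) : Sum.elim f g a = Sum.elim f g b ↔ Sum.elim f' g' a = Sum.elim f' g' b :=
    Setoid.ext_iff.1 e a b
  choose s hs using h
  choose s' hs' using h'
  -- The sections `s` and `s'` choose preimages under both copairings. Equality of kernels makes the
  -- other copairing insensitive to the choice, so the two induced maps of apices are mutually
  -- inverse.
  have hu (a) : Sum.elim f' g' (s (Sum.elim f g a)) = Sum.elim f' g' a := (he _ _).1 (hs _)
  have hv (a) : Sum.elim f g (s' (Sum.elim f' g' a)) = Sum.elim f g a := (he _ _).2 (hs' _)
  let d : F.ob k ≅ F.ob l :=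
    { hom := fun t => Sum.elim f' g' (s t)
      inv := fun t => Sum.elim f g (s' t)
      hom_inv_id := funext fun t => (hv (s t)).trans (hs t)
      inv_hom_id := funext fun t => (hu (s' t)).trans (hs' t) }
  exact cospanMk_eq_iff.2 ⟨d, funext fun t => hu (.inl t), funext fun t => hu (.inr t)⟩

/-- Jointly surjective cospans are normal forms for corelations, and the kernel determines them;
conversely each equivalence relation is the kernel of its quotient map. -/
theorem corelToER_bijective (n m : ℕ) :
    Function.Bijective (Mor.map corelToER : (corel surjInj).Hom n m → ER.Hom n m) := by
  constructor
  · intro x y hxy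
    obtain ⟨k, f, g, h, rfl⟩ := corel_exists_surjective x
    obtain ⟨l, f', g', h', rfl⟩ := corel_exists_surjective y
    exact congrArg (Quot.mk _) (cospanMk_eq_of_ker_eq h h' hxy)
  · intro e
    obtain ⟨k, f, g, h⟩ := cospanKer_surjective e
    exact ⟨corelMk surjInj f g, h⟩

/-- The isomorphism between corelations of functions and equivalence relations. -/
noncomputable def corelIsoER : corel surjInj ≅ ER := isoOfBijective corelToER corelToER_bijective

/-! Spans of injections as corelations. -/

/-- The comparison map from a pushout of a pullback of injections is injective. -/
theorem pushout_of_pullback_injective {z x y p q : ℕ} {f : InjFun x z} {g : InjFun y z}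
    {h : InjFun p x} {i : InjFun p y}
    (sq : IsPushout (Inj.op.ar f) (Inj.op.ar g) (Inj.op.ar h) (Inj.op.ar i))
    {k : Fin x → Fin q} {l : Fin y → Fin q}
    (po : IsPushout (F.ar h.1) (F.ar i.1) (F.ar k) (F.ar l)) (d : Fin q → Fin z)
    (hk : ∀ t, d (k t) = f.1 t) (hl : ∀ t, d (l t) = g.1 t) : Function.Injective d := by
  -- Elements of the two legs with the same image in `z` come from a common element of the pullback,
  -- so the pushout already identifies them.
  have cross (a : Fin x) (b : Fin y) (hab : d (k a) = d (l b)) : k a = l b := by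
    obtain ⟨t, rfl, rfl⟩ := inj_isPullback_ex sq a b (by rw [← hk, ← hl, hab])
    exact congrFun po.w t
  intro s t hst
  -- Both legs cover the pushout. For two elements from the same leg, injectivity of `f` or `g`
  -- suffices; for different legs, `cross` applies.
  obtain ⟨a, rfl⟩ | ⟨a, rfl⟩ := f_isPushout_surj po s <;>
    obtain ⟨b, rfl⟩ | ⟨b, rfl⟩ := f_isPushout_surj po t
  · rw [f.2 (by rw [← hk, ← hk, hst] : f.1 a = f.1 b)]
  · exact cross a b hst
  · exact (cross b a hst.symm).symm
  · rw [g.2 (by rw [← hl, ← hl, hst] : g.1 a = g.1 b)]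

/-- The corelations given by injections. -/
noncomputable def injToCorel : Inj ⟶ corel surjInj :=
  (injIncl ≫ F.cospanOfHom) ≫ cospanToCorel surjInj

/-- The corelations given by opposites of injections. -/
noncomputable def injOpToCorel : Inj.op ⟶ corel surjInj :=
  (Mor.op injIncl ≫ F.cospanOfOp) ≫ cospanToCorel surjInj

/-- The quotient morphism preserves composites, and the composite is computed in `Cospan(F)` by any
chosen pushout. -/
theorem injOpToCorel_comp_injToCorel {n m k p : ℕ} (f : InjFun k n) (g : InjFun k m)
    (i : Fin n → Fin p) (j : Fin m → Fin p)
    (sq : IsPushout (F.ar f.1) (F.ar g.1) (F.ar i) (F.ar j)) :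
    (corel surjInj).comp (n := n) (m := k) (k := m) (Mor.map injOpToCorel f)
      (Mor.map injToCorel g) = corelMk surjInj i j :=
  congrArg (Mor.map (cospanToCorel surjInj)) (cospan_op_comp_hom (C := F) f.1 g.1 i j sq)

theorem injToCorel_comp_injOpToCorel {n m k : ℕ} (f : InjFun n k) (g : InjFun m k) :
    (corel surjInj).comp (n := n) (m := k) (k := m) (Mor.map injToCorel f)
      (Mor.map injOpToCorel g) = corelMk (C := F) surjInj f.1 g.1 :=
  congrArg (Mor.map (cospanToCorel surjInj)) (cospan_fac (C := F) f.1 g.1)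

/-- The morphism that sends a span of injections to the corelation of its pushout. -/
noncomputable def spanToCorel : Inj.span ⟶ corel surjInj :=
  cospanDesc (C := Inj.op) injOpToCorel injToCorel fun {z x y p} f g h i sq => by
    -- In `Inj.op` the pushout `sq` is a pullback of the injections `f` and `g`, with projections
    -- `h` and `i`. The pushout of these projections is taken in `F`, and `d` is its comparison map
    -- to the common target `z` of `f` and `g`.
    obtain ⟨q, k, l, po⟩ := f_exists_isPushout
      (Subtype.val (p := Function.Injective) h) (Subtype.val (p := Function.Injective) i)
    let f₁ : InjFun x z := f
    let g₁ : InjFun y z := g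
    obtain ⟨d, hk, hl⟩ := f_isPushout_desc po f₁.1 g₁.1
      (congrFun (congrArg (Subtype.val (p := Function.Injective)) sq.w))
    refine (injToCorel_comp_injOpToCorel f₁ g₁).trans (.trans ?_
      (injOpToCorel_comp_injToCorel h i k l po).symm)
    -- The cospan of `f` and `g` is that of `k` and `l` followed by the injection `d`, so both
    -- represent the same corelation.
    refine Eq.trans ?_ (corelMk_comp (C := F) (S := surjInj) k l d
      (pushout_of_pullback_injective sq po d hk hl))
    exact congrArg₂ (corelMk surjInj) (funext fun t => (hk t).symm) (funext fun t => (hl t).symm)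

/-- By construction a span is sent to the opposite of its left leg followed by its right leg, and
this composite is the pushout cospan. -/
theorem spanToCorel_map {n m k p : ℕ} (f : InjFun k n) (g : InjFun k m) (i : Fin n → Fin p)
    (j : Fin m → Fin p) (sq : IsPushout (F.ar f.1) (F.ar g.1) (F.ar i) (F.ar j)) :
    Mor.map spanToCorel (spanMk (A := Inj) f g) = corelMk surjInj i j :=
  injOpToCorel_comp_injToCorel f g i j sq

theorem spanOfHom_spanToCorel : Inj.spanOfHom ≫ spanToCorel = injToCorel :=
  Mor.hom_ext fun {n _} f =>
    (congrArg (fun t => (corel surjInj).comp t (Mor.map injToCorel f))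
      (Mor.map_id injOpToCorel n)).trans ((corel surjInj).id_comp _)

theorem spanOfOp_spanToCorel : Inj.spanOfOp ≫ spanToCorel = injOpToCorel :=
  Mor.hom_ext fun {_ m} f =>
    (congrArg ((corel surjInj).comp (Mor.map injOpToCorel f))
      (Mor.map_id injToCorel m)).trans ((corel surjInj).comp_id _)

/-- An injection followed by its opposite is the identity span. -/
theorem span_hom_comp_op {k l : ℕ} (i : InjFun k l) :
    Inj.span.comp (n := k) (m := l) (k := k) (Mor.map Inj.spanOfHom i) (Mor.map Inj.spanOfOp i) =
      Inj.span.id k :=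
  cospan_op_comp_hom (C := Inj.op) i i (Inj.id k) (Inj.id k)
    -- Injectivity of `i` says exactly that its pullback along itself is given by identities.
    (inj_isPullback_mk (f := i) (g := i) (h := Inj.id k) (i := Inj.id k) (fun _ => rfl)
      fun a _ hab => ⟨a, rfl, i.2 hab⟩)

/-! ### The pushout square. -/

/-- The universal property of the square of corelations. -/
theorem corel_existsUnique_desc (P : PROP.{w}) (G : Mor F.cospan P) (H : Mor Inj.span P)
    (hl : Mor.trans (injIncl ≫ F.cospanOfHom) G = Mor.trans Inj.spanOfHom H)
    (hr : Mor.trans (Mor.op injIncl ≫ F.cospanOfOp) G = Mor.trans Inj.spanOfOp H) :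
    ∃! K : Mor (corel surjInj) P,
      Mor.trans (cospanToCorel surjInj) K = G ∧ Mor.trans spanToCorel K = H := by
  have hG {k l : ℕ} (i : F.Hom k l) (hi : surjInj.M (F.ar i)) :
      P.comp (G.map (Mor.map F.cospanOfHom i)) (G.map (Mor.map F.cospanOfOp i)) = P.id k := by
    -- The right class consists of the injections, so `i` is an arrow of `Inj`. There `G` and `H`
    -- agree, and the equation can be checked in `Span(Inj)`.
    let j : InjFun k l := ⟨i, hi⟩
    have el : G.map (Mor.map F.cospanOfHom i) = H.map (Mor.map Inj.spanOfHom j) :=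
      congrArg (fun K : Mor Inj P => K.map j) hl
    have er : G.map (Mor.map F.cospanOfOp i) = H.map (Mor.map Inj.spanOfOp j) :=
      congrArg (fun K : Mor Inj.op P => K.map (n := l) (m := k) j) hr
    rw [el, er, ← H.map_comp, span_hom_comp_op j, H.map_id]
  refine ⟨corelDesc surjInj G hG, ⟨rfl, ?_⟩, fun K hK => ?_⟩
  · refine cospan_hom_ext (C := Inj.op) ?_ ?_
    · exact (congrArg (fun T : Mor Inj.op (corel surjInj) => Mor.trans T (corelDesc surjInj G hG))
        spanOfOp_spanToCorel).trans hr
    · exact (congrArg (fun T : Mor Inj (corel surjInj) => Mor.trans T (corelDesc surjInj G hG))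
        spanOfHom_spanToCorel).trans hl
  · exact corel_hom_ext hK.1

/-- The universal property of the square of equivalence relations. -/
theorem er_existsUnique_desc (P : PROP.{w}) (G : Mor F.cospan P) (H : Mor Inj.span P)
    (hl : Mor.trans (injIncl ≫ F.cospanOfHom) G = Mor.trans Inj.spanOfHom H)
    (hr : Mor.trans (Mor.op injIncl ≫ F.cospanOfOp) G = Mor.trans Inj.spanOfOp H) :
    ∃! K : Mor ER P, Mor.trans (cospanToCorel surjInj ≫ corelIsoER.hom) K = G ∧
      Mor.trans (spanToCorel ≫ corelIsoER.hom) K = H := by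
  -- The hom-sets of `P` may live in another universe, so `L` need not be an arrow of the category
  -- containing the isomorphism; the inverse laws are applied through `Mor.trans`.
  have hom_inv (L : Mor (corel surjInj) P) :
      Mor.trans corelIsoER.hom (Mor.trans corelIsoER.inv L) = L :=
    congrArg (fun T : Mor (corel surjInj) (corel surjInj) => Mor.trans T L) corelIsoER.hom_inv_id
  have inv_hom (L : Mor ER P) :
      Mor.trans corelIsoER.inv (Mor.trans corelIsoER.hom L) = L :=
    congrArg (fun T : Mor ER ER => Mor.trans T L) corelIsoER.inv_hom_id
  obtain ⟨K, ⟨hG, hH⟩, hK⟩ := corel_existsUnique_desc P G H hl hr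
  refine ⟨Mor.trans corelIsoER.inv K, ⟨?_, ?_⟩, fun L hL => ?_⟩
  · exact (congrArg (Mor.trans (cospanToCorel surjInj)) (hom_inv K)).trans hG
  · exact (congrArg (Mor.trans spanToCorel) (hom_inv K)).trans hH
  · rw [← inv_hom L, ← hK (Mor.trans corelIsoER.hom L) hL]

/-- The square of equivalence relations is a pushout in the category of props. -/
theorem er_isPushout :
    IsPushout
      (coprod.desc (injIncl ≫ F.cospanOfHom) (Mor.op injIncl ≫ F.cospanOfOp) :
        Inj ⨿ Inj.op ⟶ F.cospan)
      (coprod.desc Inj.spanOfHom Inj.spanOfOp : Inj ⨿ Inj.op ⟶ Inj.span)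
      (cospanToCorel surjInj ≫ corelIsoER.hom) (spanToCorel ≫ corelIsoER.hom) := by
  have desc (s : PushoutCocone
      (coprod.desc (injIncl ≫ F.cospanOfHom) (Mor.op injIncl ≫ F.cospanOfOp) :
        Inj ⨿ Inj.op ⟶ F.cospan)
      (coprod.desc Inj.spanOfHom Inj.spanOfOp : Inj ⨿ Inj.op ⟶ Inj.span)) :=
    -- Restricting the cocone condition to the two summands of the coproduct gives the two
    -- compatibility hypotheses.
    er_existsUnique_desc s.pt s.inl s.inr
      ((coprod.inl_desc_assoc _ _ s.inl).symm.trans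
        ((congrArg (fun T => coprod.inl ≫ T) s.condition).trans (coprod.inl_desc_assoc _ _ s.inr)))
      ((coprod.inr_desc_assoc _ _ s.inl).symm.trans
        ((congrArg (fun T => coprod.inr ≫ T) s.condition).trans (coprod.inr_desc_assoc _ _ s.inr)))
  refine ⟨⟨?_⟩, ⟨PushoutCocone.IsColimit.mk _ (fun s => (desc s).choose)
    (fun s => (desc s).choose_spec.1.1) (fun s => (desc s).choose_spec.1.2)
    fun s K hl hr => (desc s).choose_spec.2 K ⟨hl, hr⟩⟩⟩
  -- The square commutes on each summand: both paths send an injection, or its opposite, to the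
  -- corelation it represents and then to its kernel.
  refine coprod.hom_ext ?_ ?_
  · rw [coprod.inl_desc_assoc, coprod.inl_desc_assoc, ← Category.assoc, ← Category.assoc,
      spanOfHom_spanToCorel]
    rfl
  · rw [coprod.inr_desc_assoc, coprod.inr_desc_assoc, ← Category.assoc, ← Category.assoc,
      spanOfOp_spanToCorel]
    rfl

end PROP

theorem mainTheorem9 :
    ∃ (φ : PROP.corel PROP.surjInj ≅ PROP.ER) (Pi : PROP.Inj.span ⟶ PROP.corel PROP.surjInj),
      (∀ (n m k : ℕ) (f : Fin n → Fin k) (g : Fin m → Fin k),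
        PROP.Mor.map φ.hom (PROP.corelMk PROP.surjInj f g) = Setoid.ker (Sum.elim f g)) ∧
      (∀ (n m k p : ℕ) (f : PROP.InjFun k n) (g : PROP.InjFun k m) (i : Fin n → Fin p)
        (j : Fin m → Fin p),
        IsPushout (PROP.F.ar f.1) (PROP.F.ar g.1) (PROP.F.ar i) (PROP.F.ar j) →
          PROP.Mor.map Pi (PROP.spanMk (A := PROP.Inj) f g) = PROP.corelMk PROP.surjInj i j) ∧
      IsPushout
        (coprod.desc (PROP.injIncl ≫ PROP.F.cospanOfHom)
          (PROP.Mor.op PROP.injIncl ≫ PROP.F.cospanOfOp) :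
          PROP.Inj ⨿ PROP.Inj.op ⟶ PROP.F.cospan)
        (coprod.desc PROP.Inj.spanOfHom PROP.Inj.spanOfOp :
          PROP.Inj ⨿ PROP.Inj.op ⟶ PROP.Inj.span)
        (PROP.cospanToCorel PROP.surjInj ≫ φ.hom) (Pi ≫ φ.hom) ∧
      ∀ (P : PROP.{w}) (G : PROP.Mor PROP.F.cospan P) (H : PROP.Mor PROP.Inj.span P),
        PROP.Mor.trans (PROP.injIncl ≫ PROP.F.cospanOfHom) G =
          PROP.Mor.trans PROP.Inj.spanOfHom H →
        PROP.Mor.trans (PROP.Mor.op PROP.injIncl ≫ PROP.F.cospanOfOp) G =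
          PROP.Mor.trans PROP.Inj.spanOfOp H →
        ∃! K : PROP.Mor PROP.ER P,
          PROP.Mor.trans (PROP.cospanToCorel PROP.surjInj ≫ φ.hom) K = G ∧
            PROP.Mor.trans (Pi ≫ φ.hom) K = H :=
  -- The formula for `φ` holds by `rfl` since the kernel is computed on the representing cospan.
  ⟨PROP.corelIsoER, PROP.spanToCorel, fun _ _ _ _ _ => rfl,
    fun _ _ _ _ f g i j sq => PROP.spanToCorel_map f g i j sq, PROP.er_isPushout,
    PROP.er_existsUnique_desc⟩
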